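/- Let $\mathfrak g$ be the Kac-Moody algebra over $\mathbb C$ of a generalized Cartan matrix, with Cartan subalgebra $\mathfrak h$ and triangular decomposition $\mathfrak g=N^-\oplus\mathfrak h\oplus N^+$. Put $\mathfrak g'=[\mathfrak g,\mathfrak g]$, $\mathfrak h'=\mathfrak h\cap\mathfrak g'$, and write $\mathfrak h=\mathfrak h'\oplus\mathfrak h''$. Let $A=\mathbb C[t_1^{\pm1},\dots,t_n^{\pm1}]$, $\mathfrak g_A=\mathfrak g'\otimes A\oplus\mathfrak h''$, $\mathfrak h_A=\mathfrak h'\otimes A\oplus\mathfrak h''$ and $\widetilde{\mathfrak g}_A=\mathfrak g_A\oplus D$, where $D$ is the abelian Lie algebra with basis $d_1,\dots,d_n$, acting by $[d_i,X\otimes t^m]=m_iX\otimes t^m$ and $[d_i,\mathfrak h'']=0$. Let $\psi:\mathfrak h_A\to\mathbb C$ be linear, and let $V(\psi)$ be the irreducible quotient of the $\mathfrak g_A$-module induced from the one-dimensional module of $(N^+\otimes A)\oplus\mathfrak h_A$ on which $N^+\otimes A$ acts by $0$ and $\mathfrak h_A$ acts by $\psi$. Let $\widetilde{\mathfrak g}_A$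 act on $V(\psi)\otimes A$ by $$(X\otimes t^m)(w\otimes t^k)=\big((X\otimes t^m)w\big)\otimes t^{m+k},\qquad h(w\otimes t^k)=(hw)\otimes t^k,\qquad d_i(w\otimes t^k)=k_i\,(w\otimes t^k)$$ for $X\in\mathfrak g'$, $h\in\mathfrak h''$, $w\in V(\psi)$, $m,k\in\mathbb Z^n$. Let $A_\psi\subseteq A$ be the subalgebra generated by the elements $\psi(h\otimes t^m)\,t^m$ with $h\in\mathfrak h'$, $m\in\mathbb Z^n$, and assume that $A_\psi=\mathbb C[t_1^{\pm r_1},\dots,t_n^{\pm r_n}]$ for positive integers $r_1,\dots,r_n$. Put $R=r_1\cdots r_n$, $\overline\Gamma=\bigoplus_{i}\mathbb Z/r_i\mathbb Z$, and let $\xi_i$ be a primitive $r_i$-th root of unity. Let $\sigma_i$ be the automorphism of $V(\psi)$ induced by the automorphism of $\mathfrak g_A$ that sends $X\otimes t^m$ to $\xi_i^{m_i}X\otimes t^m$ and is the identity on $\mathfrak h''$. That is, $\sigma_i$ fixes the image of the generator $1$ of the induced module, and $\sigma_i((X\otimes t^m)w)=\xi_i^{m_i}(X\otimes t^m)\sigma_i(w)$.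 Define $$\widetilde\eta_i(w\otimes p(t))=\sigma_i(w)\otimes p(t_1,\dots,\xi_i^{-1}t_i,\dots,t_n)\qquad(w\in V(\psi),\ p\in A),$$ and for $k=(k_1,\dots,k_n)\in\overline\Gamma$ put $$(V(\psi)\otimes A)_k=\{w\in V(\psi)\otimes A\mid \widetilde\eta_i w=\xi_i^{-k_i}w,\ 1\le i\le n\}.$$ Let $v$ be a highest weight vector of $V(\psi)$, i.e. $v\neq0$, $(N^+\otimes A)v=0$ and $hv=\psi(h)v$ for all $h\in\mathfrak h_A$. Then for every $k\in\overline\Gamma$, and every representative of $k$ in $\mathbb Z^n$ (again denoted $k$), the $\widetilde{\mathfrak g}_A$-submodule of $V(\psi)\otimes A$ generated by $v\otimes t^k$ is the joint eigenspace: $$U(\widetilde{\mathfrak g}_A)(v\otimes t^k)=(V(\psi)\otimes A)_k .$$ Moreover each $(V(\psi)\otimes A)_k$ is an irreducible $\widetilde{\mathfrak g}_A$-module and $V(\psi)\otimes A=\bigoplus_{k\in\overline\Gamma}(V(\psi)\otimes A)_k$, so these are the $R$ irreducible components of $V(\psi)\otimes A$. -/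

import Mathlib

open scoped TensorProduct

noncomputable section

namespace LoopKM

/-! ### Kac-Moody algebras -/

/-- Generalized Cartan matrices. -/
structure IsGCM {ι : Type*} (C : Matrix ι ι ℤ) : Prop where
  diag : ∀ i, C i i = 2
  nonpos : ∀ i j, i ≠ j → C i j ≤ 0
  zero_symm : ∀ i j, C i j = 0 → C j i = 0

/-- A realization `(𝔥, Π, Π^∨)` of `C`: linearly independent simple roots and simple coroots
with `⟨α_i^∨, α_j⟩ = C i j`, where `dim 𝔥 = 2 |ι| - rank C`. -/
structure Realization {ι : Type*} [Fintype ι] (C : Matrix ι ι ℤ)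
    (𝔥 : Type*) [AddCommGroup 𝔥] [Module ℂ 𝔥] where
  finite : FiniteDimensional ℂ 𝔥
  root : ι → Module.Dual ℂ 𝔥
  coroot : ι → 𝔥
  root_indep : LinearIndependent ℂ root
  coroot_indep : LinearIndependent ℂ coroot
  pairing : ∀ i j, root j (coroot i) = (C i j : ℂ)
  finrank_add_rank :
    Module.finrank ℂ 𝔥 + (C.map (Int.cast : ℤ → ℂ)).rank = 2 * Fintype.card ι

/-- Generators `e_i`, `f_i` and the elements of `𝔥`. -/
inductive Gen (ι : Type*) (𝔥 : Type*)
  | e : ι → Gen ι 𝔥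
  | f : ι → Gen ι 𝔥
  | h : 𝔥 → Gen ι 𝔥

section KacMoody

variable {ι : Type*} [Fintype ι] [DecidableEq ι] {C : Matrix ι ι ℤ}
  {𝔥 : Type*} [AddCommGroup 𝔥] [Module ℂ 𝔥] (ρ : Realization C 𝔥)

local notation "E" => fun i => FreeLieAlgebra.of ℂ (Gen.e (ι := ι) (𝔥 := 𝔥) i)
local notation "F" => fun i => FreeLieAlgebra.of ℂ (Gen.f (ι := ι) (𝔥 := 𝔥) i)
local notation "Hh" => fun x => FreeLieAlgebra.of ℂ (Gen.h (ι := ι) (𝔥 := 𝔥) x)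

/-- The defining relations of the auxiliary algebra `𝔤̃(C)`: the last two say that `𝔥` enters as a
vector space. An element of this set is declared to be zero. -/
inductive Rels : FreeLieAlgebra ℂ (Gen ι 𝔥) → Prop
  | ef (i j : ι) : Rels (⁅E i, F j⁆ - if i = j then Hh (ρ.coroot i) else 0)
  | hh (x y : 𝔥) : Rels ⁅Hh x, Hh y⁆
  | he (x : 𝔥) (i : ι) : Rels (⁅Hh x, E i⁆ - ρ.root i x • E i)
  | hf (x : 𝔥) (i : ι) : Rels (⁅Hh x, F i⁆ + ρ.root i x • F i)
  | add (x y : 𝔥) : Rels (Hh (x + y) - (Hh x + Hh y))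
  | smul (c : ℂ) (x : 𝔥) : Rels (Hh (c • x) - c • Hh x)

/-- The auxiliary Lie algebra `𝔤̃(C)`. -/
def PreKM : Type _ :=
  FreeLieAlgebra ℂ (Gen ι 𝔥) ⧸
    (LieSubmodule.lieSpan ℂ (FreeLieAlgebra ℂ (Gen ι 𝔥)) {x | Rels ρ x} :
      LieIdeal ℂ (FreeLieAlgebra ℂ (Gen ι 𝔥)))
deriving LieRing, LieAlgebra ℂ

def PreKM.mk (x : FreeLieAlgebra ℂ (Gen ι 𝔥)) : PreKM ρ :=
  LieSubmodule.Quotient.mk x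

/-- The image of `𝔥` in `𝔤̃(C)`. -/
def PreKM.cartan : Submodule ℂ (PreKM ρ) :=
  Submodule.span ℂ (Set.range fun x : 𝔥 => PreKM.mk ρ (Hh x))

/-- The maximal ideal of `𝔤̃(C)` intersecting `𝔥` trivially, i.e. the sum of all such ideals. -/
def PreKM.maxIdeal : LieIdeal ℂ (PreKM ρ) :=
  sSup {I : LieIdeal ℂ (PreKM ρ) | ∀ x ∈ I, x ∈ PreKM.cartan ρ → x = 0}

/-- The Kac-Moody algebra `𝔤(C)`. -/
def KM : Type _ := PreKM ρ ⧸ PreKM.maxIdeal ρ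
deriving LieRing, LieAlgebra ℂ

def KM.mk (x : FreeLieAlgebra ℂ (Gen ι 𝔥)) : KM ρ :=
  LieSubmodule.Quotient.mk (PreKM.mk ρ x)

/-- The Cartan subalgebra `𝔥` of `𝔤(C)`. -/
def KM.cartan : Submodule ℂ (KM ρ) :=
  Submodule.span ℂ (Set.range fun x : 𝔥 => KM.mk ρ (Hh x))

/-- The subalgebra `N⁺` generated by the `e_i`. -/
def KM.pos : Submodule ℂ (KM ρ) :=
  (LieSubalgebra.lieSpan ℂ (KM ρ) (Set.range fun i : ι => KM.mk ρ (E i))).toSubmodule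

end KacMoody

/-! ### Laurent polynomials -/

/-- `A = ℂ[t_1^{±1}, …, t_n^{±1}]`. -/
def Laurent (n : ℕ) : Type := AddMonoidAlgebra ℂ (Fin n → ℤ)
deriving CommRing, Algebra ℂ

/-- The monomials, as a basis of `A`. -/
def monoBasis (n : ℕ) : Module.Basis (Fin n → ℤ) ℂ (Laurent n) :=
  AddMonoidAlgebra.basis (Fin n → ℤ) ℂ

/-- The monomial `t^m`. -/
def mono {n : ℕ} (m : Fin n → ℤ) : Laurent n :=
  (AddMonoidAlgebra.single m 1 : AddMonoidAlgebra ℂ (Fin n → ℤ))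

lemma mono_mul {n : ℕ} (k m : Fin n → ℤ) : mono k * mono m = mono (k + m) :=
  (AddMonoidAlgebra.single_mul_single k m (1 : ℂ) 1).trans (by rw [mul_one]; rfl)

lemma mono_zero {n : ℕ} : mono (0 : Fin n → ℤ) = 1 := rfl

/-- The projection of `A` onto the line spanned by `t^m`. -/
def monoProj {n : ℕ} (m : Fin n → ℤ) : Laurent n →ₗ[ℂ] Laurent n :=
  (monoBasis n).constr ℂ fun k => if k = m then mono m else 0

/-- The derivation `∑ d_i t_i ∂/∂t_i` of `A`. -/
def degDer {n : ℕ} (d : Fin n → ℂ) : Laurent n →ₗ[ℂ] Laurent n :=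
  (monoBasis n).constr ℂ fun k => (∑ i, d i * (k i : ℂ)) • mono k

/-- The character `m ↦ c^m = ∏ c_i ^ m_i`. -/
def charPow {n : ℕ} (c : Fin n → ℂˣ) (m : Fin n → ℤ) : ℂ := ((∏ i, c i ^ m i : ℂˣ) : ℂ)

/-- The algebra endomorphism `p(t) ↦ p(c_1 t_1, …, c_n t_n)` of `A`. -/
def rescale {n : ℕ} (c : Fin n → ℂˣ) : Laurent n →ₐ[ℂ] Laurent n :=
  (AddMonoidAlgebra.lift ℂ (Laurent n) (Fin n → ℤ)
    { toFun := fun m => charPow c m.toAdd • mono m.toAdd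
      map_one' := by simp [charPow, mono_zero]
      map_mul' := fun x y => by
        simp only [charPow, toAdd_mul, Pi.add_apply, zpow_add, Finset.prod_mul_distrib,
          Units.val_mul, smul_mul_smul_comm, mono_mul] } :
    AddMonoidAlgebra ℂ (Fin n → ℤ) →ₐ[ℂ] Laurent n)

/-- The subalgebra `ℂ[t_1^{±r_1}, …, t_n^{±r_n}]` of `A`. -/
def powSubalgebra {n : ℕ} (r : Fin n → ℕ) : Subalgebra ℂ (Laurent n) :=
  Algebra.adjoin ℂ (Set.range (fun i => mono (Pi.single i (r i : ℤ))) ∪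
    Set.range fun i => mono (Pi.single i (-(r i : ℤ))))

section Facts

variable {n : ℕ}

lemma monoBasis_apply (k : Fin n → ℤ) : monoBasis n k = mono k := rfl

lemma monoProj_mono (m k : Fin n → ℤ) : monoProj m (mono k) = if k = m then mono m else 0 := by
  rw [← monoBasis_apply, monoProj, Module.Basis.constr_basis]

lemma degDer_mono (d : Fin n → ℂ) (k : Fin n → ℤ) :
    degDer d (mono k) = (∑ i, d i * (k i : ℂ)) • mono k := by
  rw [← monoBasis_apply, degDer, Module.Basis.constr_basis, monoBasis_apply]

lemma rescale_mono (c : Fin n → ℂˣ) (k : Fin n → ℤ) :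
    rescale c (mono k) = charPow c k • mono k :=
  (AddMonoidAlgebra.lift_single (R := ℂ) (A := Laurent n) _ k 1).trans (one_smul _ _)

lemma charPow_zero (c : Fin n → ℂˣ) : charPow c 0 = 1 := by simp [charPow]

lemma charPow_inv_mul (c : Fin n → ℂˣ) (k : Fin n → ℤ) : charPow c⁻¹ k * charPow c k = 1 := by
  rw [charPow, charPow, ← Units.val_mul, ← Finset.prod_mul_distrib]
  simp

lemma mono_induction {P : Laurent n → Prop} (h0 : P 0) (hadd : ∀ p q, P p → P q → P (p + q))
    (hmono : ∀ (a : ℂ) k, P (a • mono k)) (p : Laurent n) : P p := by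
  rw [← (monoBasis n).linearCombination_repr p]
  induction (monoBasis n).repr p using Finsupp.induction_linear with
  | zero => simpa using h0
  | add p q hp hq => simpa using hadd _ _ hp hq
  | single m a => simpa [monoBasis_apply] using hmono a m

lemma linearMap_ext_mono {W : Type*} [AddCommGroup W] [Module ℂ W] {f g : Laurent n →ₗ[ℂ] W}
    (h : ∀ k, f (mono k) = g (mono k)) : f = g := by
  refine LinearMap.ext fun p => ?_
  induction p using mono_induction with
  | h0 => simp
  | hadd p q hp hq => simp [hp, hq]
  | hmono a k => simp [h]

lemma degDer_mul (d : Fin n → ℂ) (p q : Laurent n) :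
    degDer d (p * q) = p * degDer d q + degDer d p * q := by
  induction p using mono_induction with
  | h0 => simp
  | hadd p p' hp hp' => simp only [add_mul, map_add, hp, hp']; abel
  | hmono a k =>
    induction q using mono_induction with
    | h0 => simp
    | hadd p p' hp hp' => simp only [mul_add, map_add, hp, hp']; abel
    | hmono b l =>
      simp only [mono_mul, map_smul, degDer_mono, smul_smul, ← add_smul,
        Pi.add_apply, Int.cast_add, mul_add, Finset.sum_add_distrib, mul_smul_comm, smul_mul_assoc]
      congr 1; ring

lemma degDer_comm (d d' : Fin n → ℂ) (p : Laurent n) :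
    degDer d (degDer d' p) = degDer d' (degDer d p) := by
  induction p using mono_induction with
  | h0 => simp
  | hadd p q hp hq => simp [hp, hq]
  | hmono a k => simp only [map_smul, degDer_mono, smul_smul]; congr 1; ring

lemma degDer_comp_comm (d d' : Fin n → ℂ) : degDer d ∘ₗ degDer d' = degDer d' ∘ₗ degDer d :=
  linearMap_ext_mono fun k => degDer_comm d d' (mono k)

lemma degDer_add (d d' : Fin n → ℂ) : degDer (d + d') = degDer d + degDer d' :=
  linearMap_ext_mono fun k => by
    simp [degDer_mono, add_mul, Finset.sum_add_distrib, add_smul]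

lemma degDer_smul (a : ℂ) (d : Fin n → ℂ) : degDer (a • d) = a • degDer d :=
  linearMap_ext_mono fun k => by
    simp [degDer_mono, mul_assoc, ← Finset.mul_sum, smul_smul]

lemma rescale_inv_rescale (c : Fin n → ℂˣ) (p : Laurent n) : rescale c⁻¹ (rescale c p) = p := by
  induction p using mono_induction with
  | h0 => simp
  | hadd p q hp hq => simp [hp, hq]
  | hmono a k =>
    simp only [map_smul, rescale_mono, smul_smul]
    rw [mul_assoc, mul_comm (charPow c k), charPow_inv_mul, mul_one]

end Facts

/-! ### Loop algebras -/

section Loop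

variable {𝔤 : Type*} [LieRing 𝔤] [LieAlgebra ℂ 𝔤]

lemma loop_lie_tmul {n : ℕ} (p q : Laurent n) (x y : 𝔤) :
    ⁅p ⊗ₜ[ℂ] x, q ⊗ₜ[ℂ] y⁆ = (p * q) ⊗ₜ[ℂ] ⁅x, y⁆ := rfl

/-- The derived algebra `𝔤' = [𝔤, 𝔤]`. -/
def derived (𝔤 : Type*) [LieRing 𝔤] [LieAlgebra ℂ 𝔤] : LieIdeal ℂ 𝔤 :=
  ⁅(⊤ : LieIdeal ℂ 𝔤), (⊤ : LieIdeal ℂ 𝔤)⁆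

/-- `S ⊗ A`, inside `𝔤 ⊗ A` (the tensor factors are written in the order `A ⊗ 𝔤`). -/
def loopSub (n : ℕ) (S : Submodule ℂ 𝔤) : Submodule ℂ (Laurent n ⊗[ℂ] 𝔤) :=
  Submodule.span ℂ {y | ∃ p : Laurent n, ∃ x ∈ S, y = p ⊗ₜ[ℂ] x}

/-- `S ⊗ 1`, inside `𝔤 ⊗ A`. -/
def constSub (n : ℕ) (S : Submodule ℂ 𝔤) : Submodule ℂ (Laurent n ⊗[ℂ] 𝔤) :=
  S.map (TensorProduct.mk ℂ (Laurent n) 𝔤 1)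

lemma tmul_mem_loopSub {n : ℕ} {S : Submodule ℂ 𝔤} (p : Laurent n) {x : 𝔤} (hx : x ∈ S) :
    p ⊗ₜ[ℂ] x ∈ loopSub n S := Submodule.subset_span ⟨p, x, hx, rfl⟩

lemma lie_mem_loopSub_derived {n : ℕ} (x y : Laurent n ⊗[ℂ] 𝔤) :
    ⁅x, y⁆ ∈ loopSub n (derived 𝔤).toSubmodule := by
  induction x using TensorProduct.induction_on with
  | zero => simp
  | add a b ha hb => rw [add_lie]; exact add_mem ha hb
  | tmul p a =>
    induction y using TensorProduct.induction_on with
    | zero => simp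
    | add c d hc hd => rw [lie_add]; exact add_mem hc hd
    | tmul q b =>
      rw [loop_lie_tmul]
      exact tmul_mem_loopSub _ (LieSubmodule.lie_mem_lie (LieSubmodule.mem_top a)
        (LieSubmodule.mem_top b))

variable (H : Submodule ℂ 𝔤) (n : ℕ)

/-- The loop algebra `𝔤_A = 𝔤' ⊗ A + 𝔥 ⊗ 1 = 𝔤' ⊗ A ⊕ 𝔥''` (for any complement `𝔥''` of
`𝔥' = 𝔥 ∩ 𝔤'` in `𝔥`), a Lie subalgebra of `𝔤 ⊗ A`. -/
def loopAlg : LieSubalgebra ℂ (Laurent n ⊗[ℂ] 𝔤) :=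
  { loopSub n (derived 𝔤).toSubmodule ⊔ constSub n H with
    lie_mem' := fun {x y} _ _ => Submodule.mem_sup_left (lie_mem_loopSub_derived x y) }

/-- `𝔥_A = 𝔥' ⊗ A + 𝔥 ⊗ 1 = 𝔥' ⊗ A ⊕ 𝔥''`. -/
def cartanLoop : Submodule ℂ (loopAlg H n) :=
  (loopSub n (H ⊓ (derived 𝔤).toSubmodule) ⊔ constSub n H).comap
    (loopAlg H n).toSubmodule.subtype

/-- `N ⊗ A`, for a subspace `N` of `𝔤'`. -/
def posLoop (N : Submodule ℂ 𝔤) : Submodule ℂ (loopAlg H n) :=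
  (loopSub n N).comap (loopAlg H n).toSubmodule.subtype

variable {H n}

lemma mem_loopAlg {x : Laurent n ⊗[ℂ] 𝔤} :
    x ∈ loopAlg H n ↔ x ∈ loopSub n (derived 𝔤).toSubmodule ⊔ constSub n H := Iff.rfl

/-- An endomorphism `f ⊗ id` of `𝔤 ⊗ A` preserves `S ⊗ A + 𝔥 ⊗ 1` as soon as `f(1) ∈ ℂ`. -/
lemma rTensor_mem {f : Laurent n →ₗ[ℂ] Laurent n} (hf : ∃ a : ℂ, f 1 = a • 1)
    {S : Submodule ℂ 𝔤} {x : Laurent n ⊗[ℂ] 𝔤} (hx : x ∈ loopSub n S ⊔ constSub n H) :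
    f.rTensor 𝔤 x ∈ loopSub n S ⊔ constSub n H := by
  have : loopSub n S ⊔ constSub n H ≤ (loopSub n S ⊔ constSub n H).comap (f.rTensor 𝔤) := by
    refine sup_le ?_ ?_
    · refine Submodule.span_le.2 ?_
      rintro _ ⟨p, x, hx, rfl⟩
      exact Submodule.mem_sup_left (by simpa using tmul_mem_loopSub (f p) hx)
    · rintro _ ⟨x, hx, rfl⟩
      obtain ⟨a, ha⟩ := hf
      refine Submodule.mem_sup_right ⟨a • x, H.smul_mem a hx, ?_⟩
      simp [ha, TensorProduct.smul_tmul]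
  exact this hx

lemma monoProj_one (m : Fin n → ℤ) : ∃ a : ℂ, monoProj m (1 : Laurent n) = a • 1 := by
  rw [← mono_zero, monoProj_mono]
  split_ifs with h
  · exact ⟨1, by rw [← h, one_smul]⟩
  · exact ⟨0, by simp⟩

lemma degDer_one (d : Fin n → ℂ) : ∃ a : ℂ, degDer d (1 : Laurent n) = a • 1 :=
  ⟨_, by rw [← mono_zero, degDer_mono]⟩

/-- The component of `x ∈ 𝔤_A` of degree `m`, i.e. the part of the form `X ⊗ t^m`. -/
def comp (m : Fin n → ℤ) : loopAlg H n →ₗ[ℂ] loopAlg H n :=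
  ((monoProj m).rTensor 𝔤).restrict (p := (loopAlg H n).toSubmodule)
    (q := (loopAlg H n).toSubmodule) fun _ hx => rTensor_mem (monoProj_one m) hx

lemma coe_comp (m : Fin n → ℤ) (x : loopAlg H n) :
    (comp m x : Laurent n ⊗[ℂ] 𝔤) = (monoProj m).rTensor 𝔤 x := rfl

/-- The derivation `∑ d_i t_i ∂/∂t_i` of `𝔤_A`. -/
def loopDer (d : Fin n → ℂ) : LieDerivation ℂ (loopAlg H n) (loopAlg H n) where
  toLinearMap := ((degDer d).rTensor 𝔤).restrict (p := (loopAlg H n).toSubmodule)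
    (q := (loopAlg H n).toSubmodule) fun _ hx => rTensor_mem (degDer_one d) hx
  leibniz' x y := by
    have key : ∀ x y : Laurent n ⊗[ℂ] 𝔤, (degDer d).rTensor 𝔤 ⁅x, y⁆ =
        ⁅x, (degDer d).rTensor 𝔤 y⁆ - ⁅y, (degDer d).rTensor 𝔤 x⁆ := by
      intro x y
      induction x using TensorProduct.induction_on with
      | zero => simp
      | add a b ha hb => simp only [add_lie, map_add, lie_add, ha, hb]; abel
      | tmul p a =>
        induction y using TensorProduct.induction_on with
        | zero => simp
        | add a b ha hb => simp only [add_lie, map_add, lie_add, ha, hb]; abel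
        | tmul q b =>
          simp only [loop_lie_tmul, LinearMap.rTensor_tmul, degDer_mul,
            TensorProduct.add_tmul]
          rw [← lie_skew a b, TensorProduct.tmul_neg, TensorProduct.tmul_neg, sub_eq_add_neg,
            mul_comm q]
    exact Subtype.ext (key x y)

lemma coe_loopDer (d : Fin n → ℂ) (x : loopAlg H n) :
    (loopDer d x : Laurent n ⊗[ℂ] 𝔤) = (degDer d).rTensor 𝔤 x := rfl

/-- The abelian Lie algebra `D` with basis `d_1, …, d_n`. -/
def Deg (n : ℕ) : Type := Fin n → ℂ
deriving AddCommGroup, Module ℂ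

/-- The coordinates with respect to `d_1, …, d_n`. -/
def Deg.coord : Deg n ≃ₗ[ℂ] (Fin n → ℂ) := LinearEquiv.refl ℂ (Fin n → ℂ)

instance : LieRing (Deg n) where
  bracket _ _ := 0
  add_lie _ _ _ := (add_zero 0).symm
  lie_add _ _ _ := (add_zero 0).symm
  lie_self _ := rfl
  leibniz_lie _ _ _ := (add_zero 0).symm

instance : LieAlgebra ℂ (Deg n) where
  lie_smul c _ _ := (smul_zero c).symm

lemma loopDer_add (d d' : Fin n → ℂ) :
    (loopDer (d + d') : LieDerivation ℂ (loopAlg H n) (loopAlg H n)) = loopDer d + loopDer d' := by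
  refine LieDerivation.ext fun x => Subtype.ext ?_
  change (degDer (d + d')).rTensor 𝔤 x.1 = (degDer d).rTensor 𝔤 x.1 + (degDer d').rTensor 𝔤 x.1
  rw [degDer_add, LinearMap.rTensor_add, LinearMap.add_apply]

lemma loopDer_smul (a : ℂ) (d : Fin n → ℂ) :
    (loopDer (a • d) : LieDerivation ℂ (loopAlg H n) (loopAlg H n)) = a • loopDer d := by
  refine LieDerivation.ext fun x => Subtype.ext ?_
  change (degDer (a • d)).rTensor 𝔤 x.1 = a • (degDer d).rTensor 𝔤 x.1
  rw [degDer_smul, LinearMap.rTensor_smul, LinearMap.smul_apply]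

lemma loopDer_lie (d d' : Fin n → ℂ) :
    ⁅loopDer (H := H) d, loopDer (H := H) d'⁆ = 0 := by
  refine LieDerivation.ext fun x => Subtype.ext ?_
  rw [LieDerivation.commutator_apply]
  change (degDer d).rTensor 𝔤 ((degDer d').rTensor 𝔤 x.1) -
    (degDer d').rTensor 𝔤 ((degDer d).rTensor 𝔤 x.1) = 0
  rw [← LinearMap.rTensor_comp_apply, ← LinearMap.rTensor_comp_apply, degDer_comp_comm d d',
    sub_self]

lemma loopDer_coord_lie (d d' : Deg n) : loopDer (H := H) (Deg.coord ⁅d, d'⁆) = 0 := by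
  have h : Deg.coord ⁅d, d'⁆ = (0 : ℂ) • (0 : Fin n → ℂ) := (smul_zero (0 : ℂ)).symm
  rw [h, loopDer_smul, zero_smul]

/-- `D` acts on `𝔤_A` by `[d_i, X ⊗ t^m] = m_i X ⊗ t^m`. -/
def degHom (H : Submodule ℂ 𝔤) (n : ℕ) :
    Deg n →ₗ⁅ℂ⁆ LieDerivation ℂ (loopAlg H n) (loopAlg H n) where
  toFun d := loopDer (Deg.coord d)
  map_add' d d' := by rw [map_add, loopDer_add]
  map_smul' a d := by rw [map_smul, loopDer_smul, RingHom.id_apply]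
  map_lie' := fun {d d'} => (loopDer_coord_lie d d').trans (loopDer_lie _ _).symm

/-- `𝔤̃_A = 𝔤_A ⊕ D`. -/
abbrev extLoopAlg (H : Submodule ℂ 𝔤) (n : ℕ) : Type _ :=
  LieAlgebra.SemiDirectSum (loopAlg H n) (Deg n) (degHom H n)

/-! ### The highest weight module `V(ψ)` -/

variable (N : Submodule ℂ 𝔤) (ψ : cartanLoop H n →ₗ[ℂ] ℂ)

attribute [local instance] LieRing.ofAssociativeRing

local notation "U" => UniversalEnvelopingAlgebra ℂ (loopAlg H n)
local notation "ιU" => UniversalEnvelopingAlgebra.ι (L := loopAlg H n) ℂ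

/-- The left ideal of `U(𝔤_A)` generated by `N ⊗ A` and the `h - ψ(h)`, `h ∈ 𝔥_A`. -/
def vermaIdeal : Submodule U U :=
  Submodule.span U ({u | ∃ x ∈ posLoop H n N, u = ιU x} ∪
    {u | ∃ h : cartanLoop H n, u = ιU h - algebraMap ℂ U (ψ h)})

/-- The module `M(ψ)` induced from the one-dimensional `(N ⊗ A) ⊕ 𝔥_A`-module defined by `ψ`,
identified with the quotient of `U(𝔤_A)` by a left ideal. -/
abbrev Verma : Type _ := U ⧸ vermaIdeal N ψ

/-- The sum of all proper submodules of `M(ψ)`. -/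
def vermaRadical : Submodule U (Verma N ψ) := sSup {S | S ≠ ⊤}

/-- `V(ψ)`, the quotient of `M(ψ)` by the sum of all proper submodules. -/
def HW : Type _ := Verma N ψ ⧸ vermaRadical N ψ
deriving AddCommGroup, Module ℂ

instance : Module U (HW N ψ) := inferInstanceAs (Module U (Verma N ψ ⧸ vermaRadical N ψ))

instance : IsScalarTower ℂ U (HW N ψ) :=
  inferInstanceAs (IsScalarTower ℂ U (Verma N ψ ⧸ vermaRadical N ψ))

/-- `V(ψ)` as a module over the Lie algebra `𝔤_A`. -/
instance : LieRingModule (loopAlg H n) (HW N ψ) where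
  bracket x v := ιU x • v
  add_lie x y v := by rw [map_add, add_smul]
  lie_add x v w := smul_add _ _ _
  leibniz_lie x y v := by
    rw [LieHom.map_lie, LieRing.of_associative_ring_bracket, sub_smul, mul_smul, mul_smul,
      sub_add_cancel]

lemma HW.lie_def (x : loopAlg H n) (v : HW N ψ) : ⁅x, v⁆ = ιU x • v := rfl

instance : LieModule ℂ (loopAlg H n) (HW N ψ) where
  smul_lie a x v := by rw [HW.lie_def, map_smul, smul_assoc, HW.lie_def]
  lie_smul a x v := by
    rw [HW.lie_def, HW.lie_def, ← algebraMap_smul U a v, ← algebraMap_smul U a (ιU x • v),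
      ← mul_smul, ← mul_smul, Algebra.commutes]

/-- Highest weight vectors of `V(ψ)`. -/
structure IsHighestWeightVector (v : HW N ψ) : Prop where
  ne_zero : v ≠ 0
  pos : ∀ x ∈ posLoop H n N, ⁅x, v⁆ = 0
  cartan : ∀ h : cartanLoop H n, ⁅(h : loopAlg H n), v⁆ = ψ h • v

/-- `h ⊗ t^m ∈ 𝔥_A` for `h ∈ 𝔥'`. -/
def cartanMono (h : ↥(H ⊓ (derived 𝔤).toSubmodule)) (m : Fin n → ℤ) : cartanLoop H n :=
  ⟨⟨mono m ⊗ₜ[ℂ] (h : 𝔤), Submodule.mem_sup_left (tmul_mem_loopSub _ h.2.2)⟩,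
    Submodule.mem_sup_left (tmul_mem_loopSub _ h.2)⟩

/-- The algebra `A_ψ`: the image of `U(𝔥' ⊗ A)` under the algebra homomorphism that extends
`h ⊗ t^m ↦ ψ(h ⊗ t^m) t^m`, i.e. the subalgebra of `A` generated by these elements. -/
def weightAlgebra : Subalgebra ℂ (Laurent n) :=
  Algebra.adjoin ℂ {p | ∃ h m, p = ψ (cartanMono h m) • mono m}

/-! ### The automorphisms -/

/-- The endomorphism `X ⊗ t^m ↦ c^m X ⊗ t^m` of `𝔤_A`. -/
def twist (c : Fin n → ℂˣ) : loopAlg H n →ₗ⁅ℂ⁆ loopAlg H n :=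
  { (((rescale c).toLinearMap).rTensor 𝔤).restrict (p := (loopAlg H n).toSubmodule)
      (q := (loopAlg H n).toSubmodule)
      fun _ hx => rTensor_mem ⟨1, by simp⟩ hx with
    map_lie' := fun {x y} => Subtype.ext
      ((LieAlgebra.ExtendScalars.map (rescale c) (LieHom.id : 𝔤 →ₗ⁅ℂ⁆ 𝔤)).map_lie x.1 y.1) }

lemma coe_twist (c : Fin n → ℂˣ) (x : loopAlg H n) :
    (twist c x : Laurent n ⊗[ℂ] 𝔤) = ((rescale c).toLinearMap).rTensor 𝔤 x := rfl

lemma twist_mem_cartanLoop (c : Fin n → ℂˣ) {x : loopAlg H n} (hx : x ∈ cartanLoop H n) :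
    twist c x ∈ cartanLoop H n :=
  rTensor_mem (f := (rescale c).toLinearMap) ⟨1, by simp⟩ hx

lemma twist_mem_posLoop (c : Fin n → ℂˣ) {x : loopAlg H n} (hx : x ∈ posLoop H n N) :
    twist c x ∈ posLoop H n N := by
  have : loopSub n N ≤ (loopSub n N).comap (((rescale c).toLinearMap).rTensor 𝔤) := by
    refine Submodule.span_le.2 ?_
    rintro _ ⟨p, x, hx, rfl⟩
    exact tmul_mem_loopSub (rescale c p) hx
  exact this hx

lemma twist_inv_twist (c : Fin n → ℂˣ) (x : loopAlg H n) : twist c⁻¹ (twist c x) = x := by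
  refine Subtype.ext ?_
  rw [coe_twist, coe_twist, ← LinearMap.rTensor_comp_apply,
    show (rescale c⁻¹).toLinearMap ∘ₗ (rescale c).toLinearMap = LinearMap.id from
      LinearMap.ext (rescale_inv_rescale c)]
  simp

/-- `ψ(h ⊗ t^m) = ψ(c^m h ⊗ t^m)` on `𝔥_A`. -/
def TwistInvariant (c : Fin n → ℂˣ) : Prop :=
  ∀ (h : loopAlg H n) (hh : h ∈ cartanLoop H n),
    ψ ⟨twist c h, twist_mem_cartanLoop c hh⟩ = ψ ⟨h, hh⟩

variable {ψ} in
lemma TwistInvariant.inv {c : Fin n → ℂˣ} (hc : TwistInvariant ψ c) : TwistInvariant ψ c⁻¹ := by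
  intro h hh
  rw [← hc _ (twist_mem_cartanLoop c⁻¹ hh)]
  congr 2
  simpa using twist_inv_twist c⁻¹ h

/-- The automorphism of `U(𝔤_A)` extending `twist c`. -/
def twistU (c : Fin n → ℂˣ) : U →ₐ[ℂ] U :=
  UniversalEnvelopingAlgebra.lift ℂ (LieHom.comp ιU (twist c))

lemma twistU_ι (c : Fin n → ℂˣ) (x : loopAlg H n) : twistU c (ιU x) = ιU (twist c x) :=
  UniversalEnvelopingAlgebra.lift_ι_apply ℂ _ x

lemma twistU_inv_twistU (c : Fin n → ℂˣ) (u : U) : twistU c⁻¹ (twistU c u) = u := by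
  have : (twistU (H := H) c⁻¹).comp (twistU c) = AlgHom.id ℂ U := by
    refine UniversalEnvelopingAlgebra.hom_ext ℂ (LieHom.ext fun x => ?_)
    change twistU c⁻¹ (twistU c (ιU x)) = ιU x
    rw [twistU_ι, twistU_ι, twist_inv_twist]
  exact DFunLike.congr_fun this u

/-- `twistU c` as a semilinear map. -/
def twistUₛ (c : Fin n → ℂˣ) : U →ₛₗ[(twistU (H := H) c : U →+* U)] U where
  toFun := twistU c
  map_add' := map_add _
  map_smul' a u := map_mul _ a u

lemma vermaIdeal_le {c : Fin n → ℂˣ} (hc : TwistInvariant ψ c) :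
    vermaIdeal N ψ ≤ (vermaIdeal N ψ).comap (twistUₛ c) := by
  refine Submodule.span_le.2 ?_
  rintro _ (⟨x, hx, rfl⟩ | ⟨h, rfl⟩)
  · refine Submodule.subset_span (Or.inl ⟨twist c x, twist_mem_posLoop N c hx, ?_⟩)
    exact twistU_ι c x
  · refine Submodule.subset_span (Or.inr ⟨⟨twist c h, twist_mem_cartanLoop c h.2⟩, ?_⟩)
    rw [hc h h.2]
    refine (map_sub (twistUₛ c) _ _).trans ?_
    exact congrArg₂ _ (twistU_ι c _) ((twistU c).commutes _)

/-- The map induced on `M(ψ)`. -/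
def twistVerma {c : Fin n → ℂˣ} (hc : TwistInvariant ψ c) :
    Verma N ψ →ₛₗ[(twistU (H := H) c : U →+* U)] Verma N ψ :=
  Submodule.mapQ _ _ (twistUₛ c) (vermaIdeal_le N ψ hc)

lemma twistVerma_inv {c : Fin n → ℂˣ} (hc : TwistInvariant ψ c) (hc' : TwistInvariant ψ c⁻¹)
    (x : Verma N ψ) : twistVerma N ψ hc' (twistVerma N ψ hc x) = x := by
  obtain ⟨u, rfl⟩ := Submodule.Quotient.mk_surjective _ x
  exact congrArg _ (twistU_inv_twistU c u)

lemma twistVerma_inv' {c : Fin n → ℂˣ} (hc : TwistInvariant ψ c) (hc' : TwistInvariant ψ c⁻¹)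
    (x : Verma N ψ) : twistVerma N ψ hc (twistVerma N ψ hc' x) = x := by
  obtain ⟨u, rfl⟩ := Submodule.Quotient.mk_surjective _ x
  have h := twistU_inv_twistU c⁻¹ u
  rw [inv_inv] at h
  exact congrArg _ h

lemma vermaRadical_le {c : Fin n → ℂˣ} (hc : TwistInvariant ψ c) :
    vermaRadical N ψ ≤ (vermaRadical N ψ).comap (twistVerma N ψ hc) := by
  refine sSup_le fun S hS x hx => ?_
  refine (le_sSup (a := S.comap (twistVerma N ψ hc.inv)) fun htop => hS ?_ :
    S.comap (twistVerma N ψ hc.inv) ≤ vermaRadical N ψ) ?_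
  · refine eq_top_iff.2 fun y _ => ?_
    have : twistVerma N ψ hc y ∈ S.comap (twistVerma N ψ hc.inv) := htop ▸ Submodule.mem_top
    simpa [twistVerma_inv] using this
  · simpa [twistVerma_inv] using hx

/-- The map induced on `V(ψ)`, semilinear version. -/
def twistHWₛ {c : Fin n → ℂˣ} (hc : TwistInvariant ψ c) :
    HW N ψ →ₛₗ[(twistU (H := H) c : U →+* U)] HW N ψ :=
  Submodule.mapQ (vermaRadical N ψ) (vermaRadical N ψ) (twistVerma N ψ hc)
    (vermaRadical_le N ψ hc)

lemma twistHWₛ_inv {c : Fin n → ℂˣ} (hc : TwistInvariant ψ c) (hc' : TwistInvariant ψ c⁻¹)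
    (x : HW N ψ) : twistHWₛ N ψ hc' (twistHWₛ N ψ hc x) = x := by
  obtain ⟨u, rfl⟩ := Submodule.Quotient.mk_surjective _ x
  exact congrArg _ (twistVerma_inv N ψ hc hc' u)

lemma twistHWₛ_inv' {c : Fin n → ℂˣ} (hc : TwistInvariant ψ c) (hc' : TwistInvariant ψ c⁻¹)
    (x : HW N ψ) : twistHWₛ N ψ hc (twistHWₛ N ψ hc' x) = x := by
  obtain ⟨u, rfl⟩ := Submodule.Quotient.mk_surjective _ x
  exact congrArg _ (twistVerma_inv' N ψ hc hc' u)

lemma twistHWₛ_smul {c : Fin n → ℂˣ} (hc : TwistInvariant ψ c) (a : ℂ) (v : HW N ψ) :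
    twistHWₛ N ψ hc (a • v) = a • twistHWₛ N ψ hc v := by
  rw [← algebraMap_smul U a v, map_smulₛₗ, ← algebraMap_smul U a (twistHWₛ N ψ hc v)]
  congr 1
  exact (twistU c).commutes a

/-- The automorphism of `V(ψ)` induced by the automorphism `X ⊗ t^m ↦ c^m X ⊗ t^m` of `𝔤_A`:
it fixes the image of `1 ∈ U(𝔤_A)` and maps `(X ⊗ t^m) w` to `c^m (X ⊗ t^m) σ(w)`. -/
def twistHW {c : Fin n → ℂˣ} (hc : TwistInvariant ψ c) : HW N ψ ≃ₗ[ℂ] HW N ψ where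
  toFun := twistHWₛ N ψ hc
  invFun := twistHWₛ N ψ hc.inv
  map_add' := map_add _
  map_smul' := twistHWₛ_smul N ψ hc
  left_inv := twistHWₛ_inv N ψ hc hc.inv
  right_inv := twistHWₛ_inv' N ψ hc hc.inv

lemma twistHW_lie {c : Fin n → ℂˣ} (hc : TwistInvariant ψ c) (x : loopAlg H n) (v : HW N ψ) :
    twistHW N ψ hc ⁅x, v⁆ = ⁅twist c x, twistHW N ψ hc v⁆ := by
  change twistHWₛ N ψ hc (ιU x • v) = ιU (twist c x) • twistHWₛ N ψ hc v
  rw [map_smulₛₗ, ← twistU_ι]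
  rfl

/-! ### The module `V(ψ) ⊗ A` -/

lemma rTensor_monoProj (x : Laurent n ⊗[ℂ] 𝔤) (m : Fin n → ℤ) :
    ∃ X : 𝔤, (monoProj m).rTensor 𝔤 x = mono m ⊗ₜ[ℂ] X := by
  induction x using TensorProduct.induction_on with
  | zero => exact ⟨0, by simp⟩
  | add x y hx hy =>
    obtain ⟨X, hX⟩ := hx
    obtain ⟨Y, hY⟩ := hy
    exact ⟨X + Y, by rw [map_add, hX, hY, TensorProduct.tmul_add]⟩
  | tmul p X =>
    have : ∃ a : ℂ, monoProj m p = a • mono m := by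
      induction p using mono_induction with
      | h0 => exact ⟨0, by simp⟩
      | hadd p q hp hq =>
        obtain ⟨a, ha⟩ := hp
        obtain ⟨b, hb⟩ := hq
        exact ⟨a + b, by rw [map_add, ha, hb, add_smul]⟩
      | hmono a k =>
        rw [map_smul, monoProj_mono]
        split_ifs
        · exact ⟨a, rfl⟩
        · exact ⟨0, by simp⟩
    obtain ⟨a, ha⟩ := this
    exact ⟨a • X, by rw [LinearMap.rTensor_tmul, ha, TensorProduct.smul_tmul]⟩

/-- Every element is the finite sum of its homogeneous components. -/
lemma exists_finset_rTensor (x : Laurent n ⊗[ℂ] 𝔤) : ∃ s : Finset (Fin n → ℤ),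
    (∀ m ∉ s, (monoProj m).rTensor 𝔤 x = 0) ∧ ∑ m ∈ s, (monoProj m).rTensor 𝔤 x = x := by
  classical
  have base : ∀ (p : Laurent n) (X : 𝔤), ∃ s : Finset (Fin n → ℤ),
      ∀ t, s ⊆ t → (∀ m ∉ t, (monoProj m).rTensor 𝔤 (p ⊗ₜ[ℂ] X) = 0) ∧
        ∑ m ∈ t, (monoProj m).rTensor 𝔤 (p ⊗ₜ[ℂ] X) = p ⊗ₜ[ℂ] X := by
    intro p X
    induction p using mono_induction with
    | h0 => exact ⟨∅, fun t _ => by simp⟩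
    | hadd p q hp hq =>
      obtain ⟨s, hs⟩ := hp
      obtain ⟨s', hs'⟩ := hq
      refine ⟨s ∪ s', fun t ht => ?_⟩
      have h1 := hs t (Finset.union_subset_left ht)
      have h2 := hs' t (Finset.union_subset_right ht)
      refine ⟨fun m hm => ?_, ?_⟩
      · rw [TensorProduct.add_tmul, map_add, h1.1 m hm, h2.1 m hm, add_zero]
      · simp only [TensorProduct.add_tmul, map_add, Finset.sum_add_distrib, h1.2, h2.2]
    | hmono a k =>
      refine ⟨{k}, fun t ht => ⟨fun m hm => ?_, ?_⟩⟩
      · have : k ≠ m := fun h => hm (h ▸ ht (Finset.mem_singleton_self k))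
        simp [monoProj_mono, this]
      · have hk : k ∈ t := ht (Finset.mem_singleton_self k)
        rw [Finset.sum_eq_single_of_mem k hk]
        · simp [monoProj_mono]
        · intro m _ hm
          simp [monoProj_mono, hm.symm]
  have main : ∃ s : Finset (Fin n → ℤ),
      ∀ t, s ⊆ t → (∀ m ∉ t, (monoProj m).rTensor 𝔤 x = 0) ∧
        ∑ m ∈ t, (monoProj m).rTensor 𝔤 x = x := by
    induction x using TensorProduct.induction_on with
    | zero => exact ⟨∅, fun t _ => by simp⟩
    | tmul p X => exact base p X
    | add x y hx hy =>
      obtain ⟨s, hs⟩ := hx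
      obtain ⟨s', hs'⟩ := hy
      refine ⟨s ∪ s', fun t ht => ?_⟩
      have h1 := hs t (Finset.union_subset_left ht)
      have h2 := hs' t (Finset.union_subset_right ht)
      refine ⟨fun m hm => ?_, ?_⟩
      · rw [map_add, h1.1 m hm, h2.1 m hm, add_zero]
      · simp only [map_add, Finset.sum_add_distrib, h1.2, h2.2]
  obtain ⟨s, hs⟩ := main
  exact ⟨s, hs s subset_rfl⟩

lemma exists_finset_comp (x : loopAlg H n) : ∃ s : Finset (Fin n → ℤ),
    (∀ m ∉ s, comp m x = 0) ∧ ∑ m ∈ s, comp m x = x := by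
  obtain ⟨s, h1, h2⟩ := exists_finset_rTensor (x : Laurent n ⊗[ℂ] 𝔤)
  refine ⟨s, fun m hm => Subtype.ext (h1 m hm), Subtype.ext ?_⟩
  refine Eq.trans ?_ h2
  exact map_sum (loopAlg H n).toSubmodule.subtype _ _

lemma finite_comp (x : loopAlg H n) : {m | comp m x ≠ 0}.Finite := by
  obtain ⟨s, hs, -⟩ := exists_finset_comp x
  exact s.finite_toSet.subset fun m hm => by
    by_contra h
    exact hm (hs m h)

/-- `x` is of the form `X ⊗ t^m`. -/
def IsHomog (m : Fin n → ℤ) (x : loopAlg H n) : Prop :=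
  ∃ X : 𝔤, (x : Laurent n ⊗[ℂ] 𝔤) = mono m ⊗ₜ[ℂ] X

lemma isHomog_comp (m : Fin n → ℤ) (x : loopAlg H n) : IsHomog m (comp m x) :=
  rTensor_monoProj (x : Laurent n ⊗[ℂ] 𝔤) m

lemma IsHomog.comp_eq {m : Fin n → ℤ} {x : loopAlg H n} (hx : IsHomog m x) (k : Fin n → ℤ) :
    comp k x = if k = m then x else 0 := by
  obtain ⟨X, hX⟩ := hx
  refine Subtype.ext ?_
  rw [coe_comp, hX, LinearMap.rTensor_tmul, monoProj_mono]
  split_ifs with h1 h2 h2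
  · rw [hX, h1]
  · exact absurd h1.symm h2
  · exact absurd h2.symm h1
  · simp

lemma IsHomog.lie {k m : Fin n → ℤ} {x y : loopAlg H n} (hx : IsHomog k x) (hy : IsHomog m y) :
    IsHomog (k + m) ⁅x, y⁆ := by
  obtain ⟨X, hX⟩ := hx
  obtain ⟨Y, hY⟩ := hy
  refine ⟨⁅X, Y⁆, ?_⟩
  rw [LieSubalgebra.coe_bracket, hX, hY, loop_lie_tmul, mono_mul]

lemma homog_induction {P : loopAlg H n → Prop} (h0 : P 0) (hadd : ∀ x y, P x → P y → P (x + y))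
    (hh : ∀ m x, IsHomog m x → P x) (x : loopAlg H n) : P x := by
  obtain ⟨s, -, hs⟩ := exists_finset_comp x
  rw [← hs]
  exact Finset.sum_induction _ P hadd h0 fun m _ => hh m _ (isHomog_comp m x)

variable {N ψ}

/-- The operator `w ⊗ p ↦ (x w) ⊗ t^m p` on `V(ψ) ⊗ A`. -/
def shiftAct (m : Fin n → ℤ) : loopAlg H n →ₗ[ℂ] Module.End ℂ (HW N ψ ⊗[ℂ] Laurent n) :=
  (TensorProduct.mapBilinear (RingHom.id ℂ) (HW N ψ) (Laurent n) (HW N ψ) (Laurent n)).flip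
    (LinearMap.mulLeft ℂ (mono m)) ∘ₗ (LieModule.toEnd ℂ (loopAlg H n) (HW N ψ)).toLinearMap

lemma shiftAct_tmul (m : Fin n → ℤ) (x : loopAlg H n) (w : HW N ψ) (p : Laurent n) :
    shiftAct m x (w ⊗ₜ[ℂ] p) = ⁅x, w⁆ ⊗ₜ[ℂ] (mono m * p) := rfl

/-- The action of `𝔤_A` on `V(ψ) ⊗ A`, summed over the homogeneous components of `x`. -/
def loopAct : loopAlg H n →ₗ[ℂ] Module.End ℂ (HW N ψ ⊗[ℂ] Laurent n) where
  toFun x := ∑ᶠ m, shiftAct m (comp m x)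
  map_add' x y := by
    simp only [map_add]
    refine finsum_add_distrib ?_ ?_
    · exact (finite_comp x).subset fun m hm h => hm (by
        change shiftAct m (comp m _) = 0
        rw [h, map_zero])
    · exact (finite_comp y).subset fun m hm h => hm (by
        change shiftAct m (comp m _) = 0
        rw [h, map_zero])
  map_smul' a x := by
    simp only [map_smul, RingHom.id_apply]
    rw [smul_finsum]

lemma IsHomog.loopAct_eq {m : Fin n → ℤ} {x : loopAlg H n} (hx : IsHomog m x) :
    loopAct (N := N) (ψ := ψ) x = shiftAct m x := by
  change ∑ᶠ k, shiftAct k (comp k x) = _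
  rw [finsum_eq_single _ m]
  · rw [hx.comp_eq, if_pos rfl]
  · intro k hk
    rw [hx.comp_eq, if_neg hk, map_zero]

/-- `(X ⊗ t^m)(w ⊗ p) = ((X ⊗ t^m) w) ⊗ t^m p`. -/
lemma IsHomog.loopAct_tmul {m : Fin n → ℤ} {x : loopAlg H n} (hx : IsHomog m x) (w : HW N ψ)
    (p : Laurent n) : loopAct x (w ⊗ₜ[ℂ] p) = ⁅x, w⁆ ⊗ₜ[ℂ] (mono m * p) := by
  rw [hx.loopAct_eq, shiftAct_tmul]

lemma loopAct_lie (x y : loopAlg H n) : loopAct (N := N) (ψ := ψ) ⁅x, y⁆ =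
    loopAct x * loopAct y - loopAct y * loopAct x := by
  induction x using homog_induction with
  | h0 => simp
  | hadd x x' hx hx' => simp only [add_lie, map_add, hx, hx', add_mul, mul_add]; abel
  | hh k x hx =>
    induction y using homog_induction with
    | h0 => simp
    | hadd x x' hx hx' => simp only [lie_add, map_add, hx, hx', add_mul, mul_add]; abel
    | hh m y hy =>
      refine TensorProduct.ext' fun w p => ?_
      rw [LinearMap.sub_apply, Module.End.mul_apply, Module.End.mul_apply,
        (hx.lie hy).loopAct_tmul, hy.loopAct_tmul, hx.loopAct_tmul, hx.loopAct_tmul,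
        hy.loopAct_tmul, ← mul_assoc, ← mul_assoc, mul_comm (mono m) (mono k), mono_mul,
        ← TensorProduct.sub_tmul, lie_lie]

/-- The action of `D` on `V(ψ) ⊗ A`: `d_i (w ⊗ t^k) = k_i (w ⊗ t^k)`. -/
def degAct : Deg n →ₗ[ℂ] Module.End ℂ (HW N ψ ⊗[ℂ] Laurent n) where
  toFun d := (degDer (Deg.coord d)).lTensor (HW N ψ)
  map_add' d d' := by rw [map_add, degDer_add, LinearMap.lTensor_add]
  map_smul' a d := by rw [map_smul, degDer_smul, LinearMap.lTensor_smul, RingHom.id_apply]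

lemma degAct_tmul (d : Deg n) (w : HW N ψ) (p : Laurent n) :
    degAct d (w ⊗ₜ[ℂ] p) = w ⊗ₜ[ℂ] degDer (Deg.coord d) p := rfl

lemma degAct_comm (d d' : Deg n) :
    degAct (N := N) (ψ := ψ) d * degAct d' = degAct d' * degAct d := by
  refine TensorProduct.ext' fun w p => ?_
  rw [Module.End.mul_apply, Module.End.mul_apply, degAct_tmul, degAct_tmul, degAct_tmul,
    degAct_tmul, degDer_comm]

lemma loopAct_degHom (d : Deg n) (x : loopAlg H n) :
    loopAct (N := N) (ψ := ψ) (degHom H n d x) = degAct d * loopAct x - loopAct x * degAct d := by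
  induction x using homog_induction with
  | h0 => simp
  | hadd x x' hx hx' => simp only [map_add, hx, hx', add_mul, mul_add]; abel
  | hh k x hx =>
    have h : degHom H n d x = (∑ i, Deg.coord d i * (k i : ℂ)) • x := by
      obtain ⟨X, hX⟩ := hx
      refine Subtype.ext ?_
      change (degDer (Deg.coord d)).rTensor 𝔤 (x : Laurent n ⊗[ℂ] 𝔤) =
        (∑ i, Deg.coord d i * (k i : ℂ)) • (x : Laurent n ⊗[ℂ] 𝔤)
      rw [hX, LinearMap.rTensor_tmul, degDer_mono, TensorProduct.smul_tmul']
    refine TensorProduct.ext' fun w p => ?_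
    rw [LinearMap.sub_apply, Module.End.mul_apply, Module.End.mul_apply, h, map_smul,
      LinearMap.smul_apply, hx.loopAct_tmul, degAct_tmul, degAct_tmul, hx.loopAct_tmul,
      degDer_mul, degDer_mono, TensorProduct.tmul_add, smul_mul_assoc, TensorProduct.tmul_smul]
    abel

/-- The action of `𝔤̃_A = 𝔤_A ⊕ D` on `V(ψ) ⊗ A`. -/
instance : LieRingModule (extLoopAlg H n) (HW N ψ ⊗[ℂ] Laurent n) where
  bracket x w := loopAct x.left w + degAct x.right w
  add_lie x y w := by
    simp only [LieAlgebra.SemiDirectSum.add_eq_mk, map_add, LinearMap.add_apply]; abel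
  lie_add x w w' := by simp only [map_add]; abel
  leibniz_lie x y w := by
    have h0 : ∀ d d' : Deg n, ⁅d, d'⁆ = 0 := fun _ _ => rfl
    have hc := LinearMap.congr_fun (degAct_comm (N := N) (ψ := ψ) (H := H) x.right y.right) w
    simp only [LieAlgebra.SemiDirectSum.lie_eq_mk, map_add, map_sub, LinearMap.add_apply,
      LinearMap.sub_apply, loopAct_lie, loopAct_degHom, h0, map_zero, LinearMap.zero_apply,
      Module.End.mul_apply] at hc ⊢
    rw [hc]
    abel

lemma ext_lie_def (x : extLoopAlg H n) (w : HW N ψ ⊗[ℂ] Laurent n) :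
    ⁅x, w⁆ = loopAct x.left w + degAct x.right w := rfl

instance : LieModule ℂ (extLoopAlg H n) (HW N ψ ⊗[ℂ] Laurent n) where
  smul_lie a x w := by
    simp only [ext_lie_def, LieAlgebra.SemiDirectSum.smul_eq_mk, map_smul, LinearMap.smul_apply,
      smul_add]
  lie_smul a x w := by simp only [ext_lie_def, map_smul, smul_add]

/-! ### The joint eigenspaces -/

lemma rescale_eq_of_mem {c : Fin n → ℂˣ} {r : Fin n → ℕ} (hc : ∀ i, c i ^ r i = 1)
    {p : Laurent n} (hp : p ∈ powSubalgebra r) : rescale c p = p := by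
  have h : ∀ (i : Fin n) (a : ℤ), c i ^ a = 1 → charPow c (Pi.single i a) = 1 := by
    intro i a ha
    rw [charPow, Finset.prod_eq_one, Units.val_one]
    intro j _
    by_cases hj : j = i
    · subst hj; rw [Pi.single_eq_same, ha]
    · rw [Pi.single_eq_of_ne hj, zpow_zero]
  have hle : powSubalgebra r ≤ AlgHom.equalizer (rescale c) (AlgHom.id ℂ (Laurent n)) := by
    refine Algebra.adjoin_le ?_
    rintro _ (⟨i, rfl⟩ | ⟨i, rfl⟩)
    · change rescale c _ = _
      rw [rescale_mono, h i _ (by rw [zpow_natCast, hc i]), one_smul, AlgHom.id_apply]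
    · change rescale c _ = _
      rw [rescale_mono, h i _ (by rw [zpow_neg, zpow_natCast, hc i, inv_one]), one_smul,
        AlgHom.id_apply]
  exact hle hp

variable (ψ) in
/-- If `A_ψ = ℂ[t_1^{±r_1}, …, t_n^{±r_n}]` and `c_i ^ r_i = 1`, then `ψ` is invariant. -/
lemma twistInvariant_of_weightAlgebra_eq {c : Fin n → ℂˣ} {r : Fin n → ℕ}
    (hψ : weightAlgebra ψ = powSubalgebra r) (hc : ∀ i, c i ^ r i = 1) : TwistInvariant ψ c := by
  have hmono : ∀ h m, ψ (cartanMono h m) * charPow c m = ψ (cartanMono h m) := by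
    intro h m
    have hmem : ψ (cartanMono h m) • (mono m : Laurent n) ∈ powSubalgebra r :=
      hψ ▸ Algebra.subset_adjoin ⟨h, m, rfl⟩
    have := rescale_eq_of_mem hc hmem
    rw [map_smul, rescale_mono, smul_smul, ← sub_eq_zero, ← sub_smul, smul_eq_zero] at this
    exact sub_eq_zero.1 (this.resolve_right ((monoBasis n).ne_zero m))
  let tw : cartanLoop H n →ₗ[ℂ] cartanLoop H n :=
    (twist (H := H) c).toLinearMap.restrict fun _ hx => twist_mem_cartanLoop c hx
  let K : Submodule ℂ (Laurent n ⊗[ℂ] 𝔤) :=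
    (LinearMap.ker (ψ ∘ₗ tw - ψ)).map
      ((loopAlg H n).toSubmodule.subtype ∘ₗ (cartanLoop H n).subtype)
  have hK : loopSub n (H ⊓ (derived 𝔤).toSubmodule) ⊔ constSub n H ≤ K := by
    refine sup_le (Submodule.span_le.2 ?_) ?_
    · rintro _ ⟨p, x, hx, rfl⟩
      induction p using mono_induction with
      | h0 => rw [TensorProduct.zero_tmul]; exact K.zero_mem
      | hadd p q hp hq => rw [TensorProduct.add_tmul]; exact K.add_mem hp hq
      | hmono a m =>
        rw [← TensorProduct.smul_tmul']
        refine K.smul_mem a ⟨cartanMono ⟨x, hx⟩ m, ?_, rfl⟩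
        have : tw (cartanMono ⟨x, hx⟩ m) = charPow c m • cartanMono ⟨x, hx⟩ m := by
          refine Subtype.ext (Subtype.ext ?_)
          change rescale c (mono m) ⊗ₜ[ℂ] x = charPow c m • (mono m ⊗ₜ[ℂ] x)
          rw [rescale_mono, TensorProduct.smul_tmul']
        rw [SetLike.mem_coe, LinearMap.mem_ker, LinearMap.sub_apply, LinearMap.comp_apply, this,
          map_smul, smul_eq_mul, mul_comm, hmono, sub_self]
    · rintro _ ⟨x, hx, rfl⟩
      have hx' : (1 : Laurent n) ⊗ₜ[ℂ] x ∈ constSub n H := ⟨x, hx, rfl⟩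
      refine ⟨⟨⟨1 ⊗ₜ[ℂ] x, Submodule.mem_sup_right hx'⟩, Submodule.mem_sup_right hx'⟩, ?_, rfl⟩
      rw [SetLike.mem_coe, LinearMap.mem_ker, LinearMap.sub_apply, LinearMap.comp_apply,
        sub_eq_zero]
      congr 1
      refine Subtype.ext (Subtype.ext ?_)
      change rescale c 1 ⊗ₜ[ℂ] x = 1 ⊗ₜ[ℂ] x
      rw [map_one]
  intro h hh
  obtain ⟨k, hk, hkh⟩ := hK hh
  have hk' : k = ⟨h, hh⟩ := Subtype.ext (Subtype.ext hkh)
  subst hk'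
  exact sub_eq_zero.1 (LinearMap.mem_ker.1 hk)

/-- The map `w ⊗ p(t) ↦ σ(w) ⊗ p(c⁻¹ t)` on `V(ψ) ⊗ A`, where `σ` is the automorphism of `V(ψ)`
induced by `X ⊗ t^m ↦ c^m X ⊗ t^m`. -/
def etaTilde {c : Fin n → ℂˣ} (hc : TwistInvariant ψ c) :
    Module.End ℂ (HW N ψ ⊗[ℂ] Laurent n) :=
  TensorProduct.map (twistHW N ψ hc).toLinearMap (rescale c⁻¹).toLinearMap

lemma etaTilde_tmul {c : Fin n → ℂˣ} (hc : TwistInvariant ψ c) (w : HW N ψ) (p : Laurent n) :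
    etaTilde hc (w ⊗ₜ[ℂ] p) = twistHW N ψ hc w ⊗ₜ[ℂ] rescale c⁻¹ p := rfl

lemma etaTilde_loopAct {c : Fin n → ℂˣ} (hc : TwistInvariant ψ c) (x : loopAlg H n) :
    etaTilde (N := N) hc * loopAct x = loopAct x * etaTilde hc := by
  induction x using homog_induction with
  | h0 => simp
  | hadd x x' hx hx' => simp only [map_add, hx, hx', add_mul, mul_add]
  | hh k x hx =>
    have h : twist c x = charPow c k • x := by
      obtain ⟨X, hX⟩ := hx
      refine Subtype.ext ?_
      rw [coe_twist, hX, LinearMap.rTensor_tmul, AlgHom.toLinearMap_apply, rescale_mono,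
        ← TensorProduct.smul_tmul', ← hX]
      rfl
    refine TensorProduct.ext' fun w p => ?_
    rw [Module.End.mul_apply, Module.End.mul_apply, hx.loopAct_tmul, etaTilde_tmul, etaTilde_tmul,
      hx.loopAct_tmul, twistHW_lie, h, smul_lie, map_mul, rescale_mono, smul_mul_assoc,
      TensorProduct.tmul_smul, TensorProduct.smul_tmul', smul_smul, charPow_inv_mul, one_smul]

lemma etaTilde_degAct {c : Fin n → ℂˣ} (hc : TwistInvariant ψ c) (d : Deg n) :
    etaTilde (N := N) hc * degAct d = degAct d * etaTilde hc := by
  refine TensorProduct.ext' fun w p => ?_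
  rw [Module.End.mul_apply, Module.End.mul_apply, degAct_tmul, etaTilde_tmul, etaTilde_tmul,
    degAct_tmul]
  congr 1
  have : (rescale c⁻¹).toLinearMap ∘ₗ degDer (Deg.coord d) =
      degDer (Deg.coord d) ∘ₗ (rescale c⁻¹).toLinearMap :=
    linearMap_ext_mono fun k => by
      simp only [LinearMap.comp_apply, AlgHom.toLinearMap_apply, degDer_mono, rescale_mono,
        map_smul]
      rw [smul_comm]
  exact LinearMap.congr_fun this p

/-- `η̃` is an automorphism of the `𝔤̃_A`-module `V(ψ) ⊗ A`. -/
lemma etaTilde_lie {c : Fin n → ℂˣ} (hc : TwistInvariant ψ c) (x : extLoopAlg H n)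
    (w : HW N ψ ⊗[ℂ] Laurent n) : etaTilde hc ⁅x, w⁆ = ⁅x, etaTilde hc w⁆ := by
  have h1 := LinearMap.congr_fun (etaTilde_loopAct (N := N) hc x.left) w
  have h2 := LinearMap.congr_fun (etaTilde_degAct (N := N) hc x.right) w
  rw [Module.End.mul_apply, Module.End.mul_apply] at h1 h2
  rw [ext_lie_def, ext_lie_def, map_add, h1, h2]

lemma mulSingle_pow {r : Fin n → ℕ} {ξ : Fin n → ℂˣ} (hξ : ∀ i, IsPrimitiveRoot (ξ i) (r i))
    (i j : Fin n) : (Pi.mulSingle i (ξ i) : Fin n → ℂˣ) j ^ r j = 1 := by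
  by_cases h : j = i
  · subst h; rw [Pi.mulSingle_eq_same, (hξ j).pow_eq_one]
  · rw [Pi.mulSingle_eq_of_ne h, one_pow]

variable (N) in
/-- The automorphism `η̃_i : w ⊗ p(t) ↦ σ_i(w) ⊗ p(t_1, …, ξ_i⁻¹ t_i, …, t_n)`, where `σ_i` is the
automorphism of `V(ψ)` induced by `t_i ↦ ξ_i t_i`. -/
def etaTildeAt {r : Fin n → ℕ} (hψ : weightAlgebra ψ = powSubalgebra r) {ξ : Fin n → ℂˣ}
    (hξ : ∀ i, IsPrimitiveRoot (ξ i) (r i)) (i : Fin n) :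
    Module.End ℂ (HW N ψ ⊗[ℂ] Laurent n) :=
  etaTilde (twistInvariant_of_weightAlgebra_eq ψ hψ (mulSingle_pow hξ i))

variable (N) in
/-- The `𝔤̃_A`-submodule `(V(ψ) ⊗ A)_k`: the joint eigenspace of the `η̃_i` with eigenvalues
`ξ_i ^ (-k_i)`. -/
def jointEigenspace {r : Fin n → ℕ} (hψ : weightAlgebra ψ = powSubalgebra r) {ξ : Fin n → ℂˣ}
    (hξ : ∀ i, IsPrimitiveRoot (ξ i) (r i)) (k : (i : Fin n) → ZMod (r i)) :
    LieSubmodule ℂ (extLoopAlg H n) (HW N ψ ⊗[ℂ] Laurent n) :=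
  { (⨅ i, (etaTildeAt N hψ hξ i).eigenspace ((ξ i ^ (-((k i).val : ℤ)) : ℂˣ) : ℂ) :
      Submodule ℂ (HW N ψ ⊗[ℂ] Laurent n)) with
    lie_mem := fun {x w} hw => by
      change w ∈ (⨅ i, _ : Submodule ℂ (HW N ψ ⊗[ℂ] Laurent n)) at hw
      change _ ∈ (⨅ i, _ : Submodule ℂ (HW N ψ ⊗[ℂ] Laurent n))
      rw [Submodule.mem_iInf] at hw ⊢
      intro i
      have := hw i
      rw [Module.End.mem_eigenspace_iff] at this ⊢
      rw [etaTildeAt, etaTilde_lie]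
      rw [etaTildeAt] at this
      rw [this, lie_smul] }

end Loop

end LoopKM

end

noncomputable section

namespace LoopKM

/-! ### Joint eigenvectors -/

section Eigen

variable {K M σ κ : Type*} [Field K] [AddCommGroup M] [Module K M]

/-! Choose x in 𝔥 on which every simple root takes the value 1, and let x ⊗ 1 act on V(ψ). The f_i
have degree -1, so V(ψ) is the line ℂv plus eigenspaces for ψ(x ⊗ 1) - 1, ψ(x ⊗ 1) - 2, …
(`IsHighestWeightVector.exists_lowerWeights`). The weight space of v is therefore a line. It
contains the image of 1, so the twists σ_i fix v, and v ⊗ t^m is a joint eigenvector of the η̃_i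
whose eigenvalues depend only on m modulo r.

On v ⊗ A, the element h ⊗ t^m of 𝔥' ⊗ A multiplies the second factor by ψ(h ⊗ t^m) t^m. A submodule
containing v ⊗ p thus contains v ⊗ qp for every q in A_ψ. By the hypothesis on A_ψ, the submodule
generated by v ⊗ t^m contains every v ⊗ t^m' with m' ≡ m modulo r
(`IsHighestWeightVector.tmul_mono_mem`). Taken over all classes, these submodules contain v ⊗ A, and
irreducibility of V(ψ) makes their sum everything. Each lies in its joint eigenspace, and the joint
eigenspaces are independent, so the inclusions are equalities
(`eq_of_le_of_iSupIndep_of_iSup_eq_top`). This also gives the direct sum decomposition.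

For irreducibility, the d_i split off a vector w ⊗ t^m from a nonzero submodule S. The vectors w
arising in this way span V(ψ), so one of them has a nonzero component along v, and x ⊗ 1, which does
not shift exponents, isolates it. Hence S contains some v ⊗ t^m
(`IsHighestWeightVector.exists_tmul_mono_mem`). If S lies in a joint eigenspace, this vector already
generates that eigenspace. -/

/-- A subspace invariant under a family of operators contains, with a finite sum of joint
eigenvectors belonging to distinct systems of eigenvalues, each of the summands. -/
lemma mem_of_sum_jointEigenvectors_mem {f : σ → Module.End K M} {p : Submodule K M}
    (hp : ∀ i, ∀ x ∈ p, f i x ∈ p) {χ : κ → σ → K} (hχ : Function.Injective χ) (s : Finset κ)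
    (w : κ → M) (hw : ∀ k ∈ s, ∀ i, f i (w k) = χ k i • w k) (hs : ∑ k ∈ s, w k ∈ p) :
    ∀ k ∈ s, w k ∈ p := by
  classical
  induction s using Finset.induction_on generalizing w with
  | empty => simp
  | insert a s ha ih =>
    have hmem : ∀ b ∈ s, w b ∈ p := by
      intro b hb
      obtain ⟨i, hi⟩ : ∃ i, χ b i ≠ χ a i :=
        Function.ne_iff.1 (hχ.ne (ne_of_mem_of_not_mem hb ha))
      -- Applying f i - χ a i removes the summand at a and rescales the others. The factor at b is
      -- nonzero by the choice of i.
      have h1 : ∑ k ∈ s, (χ k i - χ a i) • w k ∈ p := by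
        have h2 : f i (∑ k ∈ insert a s, w k) - χ a i • ∑ k ∈ insert a s, w k =
            ∑ k ∈ s, (χ k i - χ a i) • w k := by
          rw [map_sum, Finset.smul_sum, ← Finset.sum_sub_distrib, Finset.sum_insert ha,
            hw a (Finset.mem_insert_self a s), sub_self, zero_add]
          exact Finset.sum_congr rfl fun k hk => by
            rw [hw k (Finset.mem_insert_of_mem hk), sub_smul]
        exact h2 ▸ p.sub_mem (hp i _ hs) (p.smul_mem _ hs)
      have h3 := ih (fun k => (χ k i - χ a i) • w k)
        (fun k hk j => by rw [map_smul, hw k (Finset.mem_insert_of_mem hk), smul_comm]) h1 b hb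
      exact (p.smul_mem_iff (sub_ne_zero.2 hi)).1 h3
    intro k hk
    rcases Finset.mem_insert.1 hk with rfl | hk
    · rw [Finset.sum_insert ha] at hs
      exact (p.add_mem_iff_left (p.sum_mem hmem)).1 hs
    · exact hmem k hk

/-- Joint eigenspaces for distinct systems of eigenvalues are independent. -/
lemma iSupIndep_iInf_eigenspace (f : σ → Module.End K M) {χ : κ → σ → K}
    (hχ : Function.Injective χ) : iSupIndep fun k => ⨅ i, (f i).eigenspace (χ k i) := by
  rw [iSupIndep_iff_finsetSum_eq_zero_imp_eq_zero]
  intro s w hw h0 k hk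
  refine (Submodule.mem_bot K).1 (mem_of_sum_jointEigenvectors_mem (f := f) (p := ⊥)
    (fun i x hx => by rw [(Submodule.mem_bot K).1 hx, map_zero]; exact zero_mem _) hχ s w
    (fun k hk i => ?_) (by rw [h0]; exact zero_mem _) k hk)
  exact Module.End.mem_eigenspace_iff.1 ((Submodule.mem_iInf _).1 (hw k hk) i)

end Eigen

/-! ### Modules generated by a highest weight vector -/

section HighestWeight

variable {L M : Type*} [LieRing L] [LieAlgebra ℂ L] [AddCommGroup M] [Module ℂ M]
  [LieRingModule L M] [LieModule ℂ L M]

variable (M) in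
/-- The sum of the eigenspaces of `x` for the eigenvalues `a - 1, a - 2, …`. -/
def lowerWeights (x : L) (a : ℂ) : Submodule ℂ M :=
  ⨆ j : ℕ, (LieModule.toEnd ℂ L M x).eigenspace (a - (j + 1))

lemma mem_lowerWeights {x : L} {a : ℂ} {w : M} (j : ℕ) (hw : ⁅x, w⁆ = (a - (j + 1)) • w) :
    w ∈ lowerWeights M x a :=
  Submodule.mem_iSup_of_mem j (Module.End.mem_eigenspace_iff.2 hw)

/-- The eigenvalues a, a - 1, a - 2, … are distinct, so an x-stable subspace contains the top
component of each of its elements. -/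
lemma mem_of_add_lowerWeights_mem {x : L} {a : ℂ} {p : Submodule ℂ M}
    (hp : ∀ w ∈ p, ⁅x, w⁆ ∈ p) {u w : M} (hu : ⁅x, u⁆ = a • u) (hw : w ∈ lowerWeights M x a)
    (h : u + w ∈ p) : u ∈ p := by
  obtain ⟨g, hg, rfl⟩ := (Submodule.mem_iSup_iff_exists_finsupp _ _).1 hw
  -- The family consists of one operator. The index `none` stands for u, and `some j` for the
  -- component of w of eigenvalue a - (j + 1).
  have := mem_of_sum_jointEigenvectors_mem (f := fun _ : Unit => LieModule.toEnd ℂ L M x) (p := p)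
    (fun _ => hp) (χ := fun (k : Option ℕ) _ => k.elim a fun j => a - (j + 1))
    (fun k l hkl => by
      have h := congrFun hkl ()
      rcases k with _ | k <;> rcases l with _ | l
      · rfl
      · change a = a - ((l : ℂ) + 1) at h
        exact absurd (by linear_combination h) (Nat.cast_add_one_ne_zero (R := ℂ) l)
      · simp [Nat.cast_add_one_ne_zero] at h
      · simpa using h)
    g.support.insertNone (fun k => k.elim u g)
    (fun k _ _ => by
      rcases k with _ | k
      · exact hu
      · exact Module.End.mem_eigenspace_iff.1 (hg k))
    (by simpa [Finset.sum_insertNone, Finsupp.sum] using h)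
  exact this none (by simp)

lemma eq_zero_of_mem_lowerWeights {x : L} {a : ℂ} {w : M} (hw : ⁅x, w⁆ = a • w)
    (h : w ∈ lowerWeights M x a) : w = 0 :=
  (Submodule.mem_bot ℂ).1 (mem_of_add_lowerWeights_mem (p := ⊥)
    (fun y hy => by rw [(Submodule.mem_bot ℂ).1 hy, lie_zero]; exact zero_mem _) hw
    (neg_mem h) (by rw [add_neg_cancel]; exact zero_mem _))

/-- The vectors obtained from `u` by acting with elements of negative degree. -/
inductive IsLowering (x : L) (u : M) : M → Prop
  | base : IsLowering x u u
  | step (j : ℕ) (y : L) (hy : ⁅x, y⁆ = (-(j + 1) : ℂ) • y) (w : M) (hw : IsLowering x u w) :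
      IsLowering x u ⁅y, w⁆

variable {x : L} {u : M} {a : ℂ}

/-- This takes the place of the Poincaré-Birkhoff-Witt theorem. In ⁅z, ⁅y, w⁆⁆ = ⁅⁅z, y⁆, w⁆ + ⁅y,
⁅z, w⁆⁆ the induction hypothesis for w, which quantifies over all of L, covers both ⁅z, y⁆ and z.
The decomposition `hL` is needed only at u itself. -/
lemma lie_mem_span_isLowering
    (hL : ∀ y : L, y ∈ Submodule.span ℂ
      {y : L | (∃ j : ℕ, ⁅x, y⁆ = (-(j + 1) : ℂ) • y) ∨ ∃ c : ℂ, ⁅y, u⁆ = c • u})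
    (y : L) {w : M} (hw : w ∈ Submodule.span ℂ {w | IsLowering x u w}) :
    ⁅y, w⁆ ∈ Submodule.span ℂ {w | IsLowering x u w} := by
  have hgen : ∀ w, IsLowering x u w → ∀ y : L,
      ⁅y, w⁆ ∈ Submodule.span ℂ {w | IsLowering x u w} := by
    intro w hw
    induction hw with
    | base =>
      intro y
      induction hL y using Submodule.span_induction with
      | mem y hy =>
        rcases hy with ⟨j, hj⟩ | ⟨c, hc⟩
        · exact Submodule.subset_span (IsLowering.step j y hj u .base)
        · rw [hc]
          exact Submodule.smul_mem _ c (Submodule.subset_span IsLowering.base)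
      | zero => rw [zero_lie]; exact zero_mem _
      | add y z _ _ hy hz => rw [add_lie]; exact add_mem hy hz
      | smul c y _ hy => rw [smul_lie]; exact Submodule.smul_mem _ c hy
    | step j y hy w _ ih =>
      intro z
      rw [leibniz_lie]
      refine add_mem (ih _) ?_
      have hz := ih z
      generalize ⁅z, w⁆ = w' at hz
      induction hz using Submodule.span_induction with
      | mem w hw => exact Submodule.subset_span (IsLowering.step j y hy w hw)
      | zero => rw [lie_zero]; exact zero_mem _
      | add y z _ _ hy hz => rw [lie_add]; exact add_mem hy hz
      | smul c y _ hy => rw [lie_smul]; exact Submodule.smul_mem _ c hy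
  induction hw using Submodule.span_induction with
  | mem w hw => exact hgen w hw y
  | zero => rw [lie_zero]; exact zero_mem _
  | add y z _ _ hy hz => rw [lie_add]; exact add_mem hy hz
  | smul c y _ hy => rw [lie_smul]; exact Submodule.smul_mem _ c hy

/-- If `𝔤` is spanned by elements of negative degree and elements having `u` as an eigenvector,
then the module generated by `u` is the sum of the line through `u` and of lower weight spaces. -/
lemma exists_sub_smul_mem_lowerWeights (hu : ⁅x, u⁆ = a • u)
    (hL : ∀ y : L, y ∈ Submodule.span ℂ
      {y : L | (∃ j : ℕ, ⁅x, y⁆ = (-(j + 1) : ℂ) • y) ∨ ∃ c : ℂ, ⁅y, u⁆ = c • u})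
    (hM : LieSubmodule.lieSpan ℂ L {u} = ⊤) (w : M) :
    ∃ c : ℂ, w - c • u ∈ lowerWeights M x a := by
  have hword : ∀ w, IsLowering x u w → w = u ∨ ∃ j : ℕ, ⁅x, w⁆ = (a - (j + 1)) • w := by
    intro w hw
    induction hw with
    | base => exact .inl rfl
    | step j y hy w _ ih =>
      right
      rcases ih with rfl | ⟨k, hk⟩
      · refine ⟨j, ?_⟩
        rw [leibniz_lie, hy, hu, smul_lie, lie_smul, ← add_smul]
        congr 1; ring
      -- The depths j + 1 and k + 1 add up to (j + k + 1) + 1.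
      · refine ⟨j + k + 1, ?_⟩
        rw [leibniz_lie, hy, hk, smul_lie, lie_smul, ← add_smul]
        congr 1; push_cast; ring
  let S : LieSubmodule ℂ L M :=
    { Submodule.span ℂ {w | IsLowering x u w} with
      lie_mem := fun {y w} hw => lie_mem_span_isLowering hL y hw }
  have hS : S = ⊤ := by
    refine eq_top_iff.2 (hM ▸ LieSubmodule.lieSpan_le.2 ?_)
    rintro _ rfl
    exact Submodule.subset_span IsLowering.base
  have hw : w ∈ Submodule.span ℂ {w | IsLowering x u w} := by
    change w ∈ S
    rw [hS]
    exact LieSubmodule.mem_top w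
  induction hw using Submodule.span_induction with
  | mem w hw =>
    rcases hword w hw with rfl | ⟨j, hj⟩
    · exact ⟨1, by rw [one_smul, sub_self]; exact zero_mem _⟩
    · exact ⟨0, by rw [zero_smul, sub_zero]; exact mem_lowerWeights j hj⟩
  | zero => exact ⟨0, by rw [zero_smul, sub_zero]; exact zero_mem _⟩
  | add y z _ _ hy hz =>
    obtain ⟨c, hc⟩ := hy
    obtain ⟨d, hd⟩ := hz
    exact ⟨c + d, by rw [add_smul, add_sub_add_comm]; exact add_mem hc hd⟩
  | smul c y _ hy =>
    obtain ⟨d, hd⟩ := hy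
    exact ⟨c * d, by rw [mul_smul, ← smul_sub]; exact Submodule.smul_mem _ c hd⟩

end HighestWeight

/-! ### Triangular decomposition -/

section Triangular

variable {ι 𝔤 : Type*} [LieRing 𝔤] [LieAlgebra ℂ 𝔤]

lemma lie_mem_lieSpan_of_eigenvectors {e : ι → 𝔤} {h : 𝔤} (he : ∀ i, ∃ c : ℂ, ⁅h, e i⁆ = c • e i)
    {y : 𝔤} (hy : y ∈ LieSubalgebra.lieSpan ℂ 𝔤 (Set.range e)) :
    ⁅h, y⁆ ∈ LieSubalgebra.lieSpan ℂ 𝔤 (Set.range e) := by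
  induction hy using LieSubalgebra.lieSpan_induction with
  | mem y hy =>
    obtain ⟨i, rfl⟩ := hy
    obtain ⟨c, hc⟩ := he i
    rw [hc]
    exact LieSubalgebra.smul_mem _ c (LieSubalgebra.subset_lieSpan ⟨i, rfl⟩)
  | zero => rw [lie_zero]; exact zero_mem _
  | add y z _ _ hy hz => rw [lie_add]; exact add_mem hy hz
  | smul c y _ hy => rw [lie_smul]; exact LieSubalgebra.smul_mem _ c hy
  | lie y z hy' hz' hy hz =>
    rw [leibniz_lie]
    exact add_mem (LieSubalgebra.lie_mem _ hy hz') (LieSubalgebra.lie_mem _ hy' hz)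

/-- Bracketing with f sends the generators into H, and H plus the subalgebra generated by the e_i
normalizes that subalgebra; the Leibniz rule does the rest. The hypotheses are loose enough to be
applied also with the e_i and f_i exchanged. -/
lemma lie_mem_sup_lieSpan {H : Submodule ℂ 𝔤} {e : ι → 𝔤} {f : 𝔤}
    (he : ∀ h ∈ H, ∀ i, ∃ c : ℂ, ⁅h, e i⁆ = c • e i) (hf : ∀ i, ⁅f, e i⁆ ∈ H)
    {y : 𝔤} (hy : y ∈ LieSubalgebra.lieSpan ℂ 𝔤 (Set.range e)) :
    ⁅f, y⁆ ∈ H ⊔ (LieSubalgebra.lieSpan ℂ 𝔤 (Set.range e)).toSubmodule := by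
  induction hy using LieSubalgebra.lieSpan_induction with
  | mem y hy =>
    obtain ⟨i, rfl⟩ := hy
    exact Submodule.mem_sup_left (hf i)
  | zero => rw [lie_zero]; exact zero_mem _
  | add y z _ _ hy hz => rw [lie_add]; exact add_mem hy hz
  | smul c y _ hy => rw [lie_smul]; exact Submodule.smul_mem _ c hy
  | lie y z hy' hz' hy hz =>
    have key : ∀ y z, z ∈ LieSubalgebra.lieSpan ℂ 𝔤 (Set.range e) →
        y ∈ H ⊔ (LieSubalgebra.lieSpan ℂ 𝔤 (Set.range e)).toSubmodule →
        ⁅y, z⁆ ∈ LieSubalgebra.lieSpan ℂ 𝔤 (Set.range e) := by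
      intro y z hz hy
      obtain ⟨h, hh, p, hp, rfl⟩ := Submodule.mem_sup.1 hy
      rw [add_lie]
      exact add_mem (lie_mem_lieSpan_of_eigenvectors (he h hh) hz)
        (LieSubalgebra.lie_mem _ hp hz)
    rw [leibniz_lie]
    refine Submodule.mem_sup_right (add_mem (key _ _ hz' hy) ?_)
    rw [← lie_skew]
    exact neg_mem (key _ _ hy' hz)

/-- Let T be the sum. By the Jacobi identity the elements y with ⁅y, T⁆ ⊆ T form a subalgebra; it
contains the generators, hence is everything. So T is itself a subalgebra, and it contains the
generators as well. Directness of the sum is not asserted. -/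
lemma triangular_decomposition {H : Submodule ℂ 𝔤} {e f : ι → 𝔤}
    (hH : ∀ h ∈ H, ∀ h' ∈ H, ⁅h, h'⁆ ∈ H)
    (he : ∀ h ∈ H, ∀ i, ∃ c : ℂ, ⁅h, e i⁆ = c • e i)
    (hf : ∀ h ∈ H, ∀ i, ∃ c : ℂ, ⁅h, f i⁆ = c • f i)
    (hef : ∀ i j, ⁅e i, f j⁆ ∈ H)
    (hgen : ∀ K : LieSubalgebra ℂ 𝔤, (∀ i, e i ∈ K) → (∀ i, f i ∈ K) → (∀ h ∈ H, h ∈ K) →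
      ∀ y, y ∈ K) (y : 𝔤) :
    y ∈ (LieSubalgebra.lieSpan ℂ 𝔤 (Set.range f)).toSubmodule ⊔ H ⊔
      (LieSubalgebra.lieSpan ℂ 𝔤 (Set.range e)).toSubmodule := by
  set N := LieSubalgebra.lieSpan ℂ 𝔤 (Set.range f)
  set P := LieSubalgebra.lieSpan ℂ 𝔤 (Set.range e)
  set T := N.toSubmodule ⊔ H ⊔ P.toSubmodule
  have hNT : N.toSubmodule ≤ T := le_sup_left.trans le_sup_left
  have hHT : H ≤ T := le_sup_right.trans le_sup_left
  have hPT : P.toSubmodule ≤ T := le_sup_right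
  have heP : ∀ i, e i ∈ P := fun i => LieSubalgebra.subset_lieSpan ⟨i, rfl⟩
  have hfN : ∀ i, f i ∈ N := fun i => LieSubalgebra.subset_lieSpan ⟨i, rfl⟩
  have hT : ∀ y : 𝔤, (∀ z ∈ N, ⁅y, z⁆ ∈ T) → (∀ z ∈ H, ⁅y, z⁆ ∈ T) → (∀ z ∈ P, ⁅y, z⁆ ∈ T) →
      ∀ z ∈ T, ⁅y, z⁆ ∈ T := by
    intro y h1 h2 h3 z hz
    obtain ⟨z', hz', p, hp, rfl⟩ := Submodule.mem_sup.1 hz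
    obtain ⟨m, hm, h, hh, rfl⟩ := Submodule.mem_sup.1 hz'
    rw [lie_add, lie_add]
    exact add_mem (add_mem (h1 m hm) (h2 h hh)) (h3 p hp)
  let K : LieSubalgebra ℂ 𝔤 :=
    { carrier := {y | ∀ z ∈ T, ⁅y, z⁆ ∈ T}
      add_mem' := fun hx hy z hz => by rw [add_lie]; exact add_mem (hx z hz) (hy z hz)
      zero_mem' := fun z _ => by rw [zero_lie]; exact zero_mem _
      smul_mem' := fun c x hx z hz => by rw [smul_lie]; exact Submodule.smul_mem _ c (hx z hz)
      lie_mem' := fun {x y} hx hy z hz => by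
        rw [lie_lie]
        exact sub_mem (hx _ (hy z hz)) (hy _ (hx z hz)) }
  have hK : ∀ y : 𝔤, ∀ z ∈ T, ⁅y, z⁆ ∈ T := by
    refine hgen K (fun i => hT (e i) ?_ ?_ ?_) (fun i => hT (f i) ?_ ?_ ?_)
      (fun h hh => hT h ?_ ?_ ?_)
    · intro z hz
      exact sup_le hHT hNT (lie_mem_sup_lieSpan hf (hef i) hz)
    · intro z hz
      obtain ⟨c, hc⟩ := he z hz i
      rw [← lie_skew, hc]
      exact hPT (neg_mem (P.smul_mem c (heP i)))
    · intro z hz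
      exact hPT (P.lie_mem (heP i) hz)
    · intro z hz
      exact hNT (N.lie_mem (hfN i) hz)
    · intro z hz
      obtain ⟨c, hc⟩ := hf z hz i
      rw [← lie_skew, hc]
      exact hNT (neg_mem (N.smul_mem c (hfN i)))
    · intro z hz
      refine sup_le hHT hPT (lie_mem_sup_lieSpan he (fun j => ?_) hz)
      rw [← lie_skew]
      exact neg_mem (hef j i)
    · intro z hz
      exact hNT (lie_mem_lieSpan_of_eigenvectors (hf h hh) hz)
    · intro z hz
      exact hHT (hH h hh z hz)
    · intro z hz
      exact hPT (lie_mem_lieSpan_of_eigenvectors (he h hh) hz)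
  exact hgen { T with lie_mem' := fun {y z} _ hz => hK y z hz } (fun i => hPT (heP i))
    (fun i => hNT (hfN i)) (fun h hh => hHT hh) y

lemma lieSpan_le_span_negative {f : ι → 𝔤} {x : 𝔤} (hx : ∀ i, ⁅x, f i⁆ = (-1 : ℂ) • f i) :
    (LieSubalgebra.lieSpan ℂ 𝔤 (Set.range f)).toSubmodule ≤
      Submodule.span ℂ {y | ∃ j : ℕ, ⁅x, y⁆ = (-(j + 1) : ℂ) • y} := by
  intro y hy
  induction hy using LieSubalgebra.lieSpan_induction with
  | mem y hy =>
    obtain ⟨i, rfl⟩ := hy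
    exact Submodule.subset_span ⟨0, by rw [hx]; simp⟩
  | zero => exact zero_mem _
  | add y z _ _ hy hz => exact add_mem hy hz
  | smul c y _ hy => exact Submodule.smul_mem _ c hy
  | lie y z hy' hz' hy hz =>
    clear hy' hz'
    induction hy using Submodule.span_induction with
    | zero => rw [zero_lie]; exact zero_mem _
    | add y y' _ _ hy hy' => rw [add_lie]; exact add_mem hy hy'
    | smul c y _ hy => rw [smul_lie]; exact Submodule.smul_mem _ c hy
    | mem y hy =>
      induction hz using Submodule.span_induction with
      | zero => rw [lie_zero]; exact zero_mem _
      | add y y' _ _ hy hy' => rw [lie_add]; exact add_mem hy hy'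
      | smul c y _ hy => rw [lie_smul]; exact Submodule.smul_mem _ c hy
      | mem z hz =>
        obtain ⟨j, hj⟩ := hy
        obtain ⟨k, hk⟩ := hz
        refine Submodule.subset_span ⟨j + k + 1, ?_⟩
        rw [leibniz_lie, hj, hk, smul_lie, lie_smul, ← add_smul]
        congr 1; push_cast; ring

lemma lie_mem_derived (x y : 𝔤) : ⁅x, y⁆ ∈ derived 𝔤 :=
  LieSubmodule.lie_mem_lie (LieSubmodule.mem_top x) (LieSubmodule.mem_top y)

lemma mem_derived_of_lie_eq_smul {x y : 𝔤} {c : ℂ} (hc : c ≠ 0) (h : ⁅x, y⁆ = c • y) :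
    y ∈ derived 𝔤 := by
  have := (derived 𝔤).smul_mem c⁻¹ (lie_mem_derived x y)
  rwa [h, smul_smul, inv_mul_cancel₀ hc, one_smul] at this

end Triangular

/-! ### Kac-Moody algebras -/

/-- Linear independence of the simple roots gives a functional on 𝔥* with value 1 on each of them,
and by finite dimensionality it is evaluation at a point. This point grades the algebra by height:
degree 1 on e_i, degree -1 on f_i. -/
lemma Realization.exists_root_eq_one {ι : Type*} [Fintype ι] {C : Matrix ι ι ℤ} {𝔥 : Type*}
    [AddCommGroup 𝔥] [Module ℂ 𝔥] (ρ : Realization C 𝔥) : ∃ x : 𝔥, ∀ i, ρ.root i x = 1 := by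
  have := ρ.finite
  obtain ⟨φ, hφ⟩ := LinearMap.exists_extend
    ((Module.Basis.span ρ.root_indep).constr ℂ fun _ => (1 : ℂ))
  refine ⟨(Module.evalEquiv ℂ 𝔥).symm φ, fun i => ?_⟩
  rw [Module.apply_evalEquiv_symm_apply]
  have h := LinearMap.congr_fun hφ (Module.Basis.span ρ.root_indep i)
  rwa [Module.Basis.constr_basis, LinearMap.comp_apply, Submodule.subtype_apply,
    Module.Basis.span_apply] at h

section KacMoody

variable {ι : Type*} [Fintype ι] [DecidableEq ι] {C : Matrix ι ι ℤ}
  {𝔥 : Type*} [AddCommGroup 𝔥] [Module ℂ 𝔥] (ρ : Realization C 𝔥)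

/-- The quotient map from the free Lie algebra, as a homomorphism. -/
def KM.mkHom : FreeLieAlgebra ℂ (Gen ι 𝔥) →ₗ⁅ℂ⁆ KM ρ where
  toFun := KM.mk ρ
  map_add' _ _ := rfl
  map_smul' _ _ := rfl
  map_lie' := rfl

lemma KM.mkHom_eq_zero {x : FreeLieAlgebra ℂ (Gen ι 𝔥)} (hx : Rels ρ x) : KM.mkHom ρ x = 0 := by
  have h : PreKM.mk ρ x = 0 :=
    (LieSubmodule.Quotient.mk_eq_zero _).2 (LieSubmodule.subset_lieSpan hx)
  change LieSubmodule.Quotient.mk (PreKM.mk ρ x) = _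
  rw [h]
  rfl

/-- The generator `e_i`. -/
def KM.e (i : ι) : KM ρ := KM.mk ρ (FreeLieAlgebra.of ℂ (Gen.e i))

/-- The generator `f_i`. -/
def KM.f (i : ι) : KM ρ := KM.mk ρ (FreeLieAlgebra.of ℂ (Gen.f i))

/-- The map from `𝔥` to the Kac-Moody algebra. -/
def KM.h : 𝔥 →ₗ[ℂ] KM ρ where
  toFun x := KM.mk ρ (FreeLieAlgebra.of ℂ (Gen.h x))
  map_add' x y := sub_eq_zero.1 (KM.mkHom_eq_zero ρ (.add x y))
  map_smul' c x := sub_eq_zero.1 (KM.mkHom_eq_zero ρ (.smul c x))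

/-- The subalgebra `N⁻` generated by the `f_i`. -/
def KM.neg : Submodule ℂ (KM ρ) :=
  (LieSubalgebra.lieSpan ℂ (KM ρ) (Set.range (KM.f ρ))).toSubmodule

lemma KM.exists_h_eq {y : KM ρ} (hy : y ∈ KM.cartan ρ) : ∃ x, KM.h ρ x = y := by
  have : KM.cartan ρ ≤ LinearMap.range (KM.h ρ) :=
    Submodule.span_le.2 (by rintro _ ⟨x, rfl⟩; exact ⟨x, rfl⟩)
  exact this hy

lemma KM.h_mem_cartan (x : 𝔥) : KM.h ρ x ∈ KM.cartan ρ := Submodule.subset_span ⟨x, rfl⟩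

lemma KM.h_lie_h (x y : 𝔥) : ⁅KM.h ρ x, KM.h ρ y⁆ = 0 := KM.mkHom_eq_zero ρ (.hh x y)

lemma KM.h_lie_e (x : 𝔥) (i : ι) : ⁅KM.h ρ x, KM.e ρ i⁆ = ρ.root i x • KM.e ρ i :=
  sub_eq_zero.1 (KM.mkHom_eq_zero ρ (.he x i))

lemma KM.h_lie_f (x : 𝔥) (i : ι) : ⁅KM.h ρ x, KM.f ρ i⁆ = -ρ.root i x • KM.f ρ i := by
  rw [neg_smul]
  exact eq_neg_of_add_eq_zero_left (KM.mkHom_eq_zero ρ (.hf x i))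

lemma KM.e_lie_f (i j : ι) : ⁅KM.e ρ i, KM.f ρ j⁆ = if i = j then KM.h ρ (ρ.coroot i) else 0 := by
  have h := KM.mkHom_eq_zero ρ (.ef i j)
  rw [map_sub, sub_eq_zero] at h
  refine Eq.trans h ?_
  split_ifs
  · rfl
  · exact map_zero _

/-- By the universal property, the quotient map from the free Lie algebra factors through K, and it
is surjective. -/
lemma KM.mem_of_generators_mem (K : LieSubalgebra ℂ (KM ρ)) (he : ∀ i, KM.e ρ i ∈ K)
    (hf : ∀ i, KM.f ρ i ∈ K) (hh : ∀ x, KM.h ρ x ∈ K) (y : KM ρ) : y ∈ K := by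
  let g : Gen ι 𝔥 → K := fun
    | .e i => ⟨KM.e ρ i, he i⟩
    | .f i => ⟨KM.f ρ i, hf i⟩
    | .h x => ⟨KM.h ρ x, hh x⟩
  have hg : K.incl.comp (FreeLieAlgebra.lift ℂ g) = KM.mkHom ρ := by
    refine FreeLieAlgebra.hom_ext fun a => ?_
    rw [LieHom.comp_apply, FreeLieAlgebra.lift_of_apply]
    cases a <;> rfl
  obtain ⟨z, rfl⟩ : ∃ z, KM.mkHom ρ z = y := by
    obtain ⟨y, rfl⟩ := LieSubmodule.Quotient.surjective_mk' _ y
    obtain ⟨z, rfl⟩ := LieSubmodule.Quotient.surjective_mk' _ y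
    exact ⟨z, rfl⟩
  rw [← hg]
  exact (FreeLieAlgebra.lift ℂ g z).2

lemma KM.mem_neg_sup_cartan_sup_pos (y : KM ρ) : y ∈ KM.neg ρ ⊔ KM.cartan ρ ⊔ KM.pos ρ := by
  refine triangular_decomposition (e := KM.e ρ) (f := KM.f ρ) ?_ ?_ ?_ ?_ ?_ y
  · intro h hh h' hh'
    obtain ⟨x, rfl⟩ := KM.exists_h_eq ρ hh
    obtain ⟨x', rfl⟩ := KM.exists_h_eq ρ hh'
    rw [KM.h_lie_h]
    exact zero_mem _
  · intro h hh i
    obtain ⟨x, rfl⟩ := KM.exists_h_eq ρ hh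
    exact ⟨_, KM.h_lie_e ρ x i⟩
  · intro h hh i
    obtain ⟨x, rfl⟩ := KM.exists_h_eq ρ hh
    exact ⟨_, KM.h_lie_f ρ x i⟩
  · intro i j
    rw [KM.e_lie_f]
    split_ifs
    · exact KM.h_mem_cartan ρ _
    · exact zero_mem _
  · exact fun K he hf hh => KM.mem_of_generators_mem ρ K he hf fun x => hh _ (KM.h_mem_cartan ρ x)

lemma KM.lieSpan_le_derived {g : ι → KM ρ} (hg : ∀ i, g i ∈ derived (KM ρ)) :
    (LieSubalgebra.lieSpan ℂ (KM ρ) (Set.range g)).toSubmodule ≤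
      (derived (KM ρ)).toSubmodule := by
  have : LieSubalgebra.lieSpan ℂ (KM ρ) (Set.range g) ≤
      LieIdeal.toLieSubalgebra ℂ (KM ρ) (derived (KM ρ)) := by
    rw [LieSubalgebra.lieSpan_le]
    rintro _ ⟨i, rfl⟩
    exact hg i
  exact this

/-- An element x of height type satisfies ⁅x, e_i⁆ = e_i. -/
lemma KM.pos_le_derived : KM.pos ρ ≤ (derived (KM ρ)).toSubmodule := by
  obtain ⟨x, hx⟩ := ρ.exists_root_eq_one
  exact KM.lieSpan_le_derived ρ fun i =>
    mem_derived_of_lie_eq_smul (by rw [hx]; exact one_ne_zero) (KM.h_lie_e ρ x i)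

end KacMoody

/-! ### The module `V(ψ)` -/

section HW

attribute [local instance] LieRing.ofAssociativeRing

variable {𝔤 : Type*} [LieRing 𝔤] [LieAlgebra ℂ 𝔤] {H : Submodule ℂ 𝔤} {n : ℕ}
  {N : Submodule ℂ 𝔤} {ψ : cartanLoop H n →ₗ[ℂ] ℂ}

local notation "U" => UniversalEnvelopingAlgebra ℂ (loopAlg H n)

/-- The elements of U preserving p form a subalgebra B containing the Lie algebra. The induced map U
→ B followed by the inclusion is the identity, by uniqueness of extensions to U, so B is all of U.
-/
lemma HW.smul_mem_of_lie_mem {p : Submodule ℂ (HW N ψ)}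
    (hp : ∀ (x : loopAlg H n), ∀ w ∈ p, ⁅x, w⁆ ∈ p) (a : U) {w : HW N ψ} (hw : w ∈ p) :
    a • w ∈ p := by
  let B : Subalgebra ℂ U :=
    { carrier := {a | ∀ w ∈ p, a • w ∈ p}
      mul_mem' := fun ha hb w hw => by rw [mul_smul]; exact ha _ (hb w hw)
      add_mem' := fun ha hb w hw => by rw [add_smul]; exact add_mem (ha w hw) (hb w hw)
      algebraMap_mem' := fun c w hw => by rw [algebraMap_smul]; exact p.smul_mem c hw }
  let j : loopAlg H n →ₗ⁅ℂ⁆ B :=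
    { toFun := fun x => ⟨UniversalEnvelopingAlgebra.ι ℂ x, hp x⟩
      map_add' := fun x y => Subtype.ext (map_add _ x y)
      map_smul' := fun c x => Subtype.ext (map_smul _ c x)
      map_lie' := fun {x y} => Subtype.ext (LieHom.map_lie _ x y) }
  have h : B.val.comp (UniversalEnvelopingAlgebra.lift ℂ j) = AlgHom.id ℂ U := by
    refine UniversalEnvelopingAlgebra.hom_ext ℂ (LieHom.ext fun x => ?_)
    change B.val (UniversalEnvelopingAlgebra.lift ℂ j (UniversalEnvelopingAlgebra.ι ℂ x)) =
      UniversalEnvelopingAlgebra.ι ℂ x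
    rw [UniversalEnvelopingAlgebra.lift_ι_apply]
    rfl
  have ha : a ∈ B := by
    have := (UniversalEnvelopingAlgebra.lift ℂ j a).2
    rwa [show ((UniversalEnvelopingAlgebra.lift ℂ j a : B) : U) = a from
      DFunLike.congr_fun h a] at this
  exact ha w hw

/-- `V(ψ)` has no proper nonzero subspace stable under `𝔤_A`. -/
lemma HW.eq_top_of_lie_mem {p : Submodule ℂ (HW N ψ)}
    (hp : ∀ (x : loopAlg H n), ∀ w ∈ p, ⁅x, w⁆ ∈ p) {w : HW N ψ} (hw : w ∈ p) (hw0 : w ≠ 0) :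
    p = ⊤ := by
  let q : Submodule U (HW N ψ) :=
    { p.toAddSubmonoid with smul_mem' := fun a _ hw => HW.smul_mem_of_lie_mem hp a hw }
  -- If the preimage of p in M(ψ) were proper, it would lie in the radical, and then w would vanish
  -- in V(ψ).
  let q' : Submodule U (Verma N ψ) := q.comap (vermaRadical N ψ).mkQ
  have hq' : q' = ⊤ := by
    by_contra h
    obtain ⟨y, rfl⟩ := Submodule.mkQ_surjective (vermaRadical N ψ) w
    exact hw0 ((Submodule.Quotient.mk_eq_zero _).2
      ((le_sSup h : q' ≤ vermaRadical N ψ) (show y ∈ q' from hw)))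
  refine eq_top_iff.2 fun z _ => ?_
  obtain ⟨y, rfl⟩ := Submodule.mkQ_surjective (vermaRadical N ψ) z
  exact (hq' ▸ Submodule.mem_top : y ∈ q')

lemma HW.lieSpan_eq_top {v : HW N ψ} (hv : v ≠ 0) :
    LieSubmodule.lieSpan ℂ (loopAlg H n) {v} = ⊤ := by
  rw [← LieSubmodule.toSubmodule_eq_top]
  exact HW.eq_top_of_lie_mem (fun x w hw => LieSubmodule.lie_mem _ hw)
    (LieSubmodule.subset_lieSpan rfl) hv

variable (N ψ) in
/-- The image of `1` in `V(ψ)`. -/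
def HW.vac : HW N ψ := (vermaRadical N ψ).mkQ ((vermaIdeal N ψ).mkQ 1)

lemma HW.smul_vac (a : U) :
    a • HW.vac N ψ = (vermaRadical N ψ).mkQ ((vermaIdeal N ψ).mkQ a) := by
  have h : a • HW.vac N ψ = (vermaRadical N ψ).mkQ ((vermaIdeal N ψ).mkQ (a • 1)) := rfl
  rw [h, smul_eq_mul, mul_one]

/-- The image of 1 generates V(ψ). Having a nonzero vector at hand avoids proving that the radical
of M(ψ) is proper. -/
lemma HW.vac_ne_zero {v : HW N ψ} (hv : v ≠ 0) : HW.vac N ψ ≠ 0 := by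
  intro h
  obtain ⟨y, rfl⟩ := Submodule.mkQ_surjective (vermaRadical N ψ) v
  obtain ⟨a, rfl⟩ := Submodule.mkQ_surjective (vermaIdeal N ψ) y
  apply hv
  rw [← HW.smul_vac, h, smul_zero]

lemma HW.lie_vac (h : cartanLoop H n) :
    ⁅(h : loopAlg H n), HW.vac N ψ⁆ = ψ h • HW.vac N ψ := by
  rw [HW.lie_def, ← algebraMap_smul U (ψ h), ← sub_eq_zero, ← sub_smul, HW.smul_vac,
    Submodule.mkQ_apply (vermaIdeal N ψ),
    (Submodule.Quotient.mk_eq_zero (vermaIdeal N ψ)).2 (Submodule.subset_span (.inr ⟨h, rfl⟩)),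
    map_zero]
  rfl

lemma twistHW_vac {c : Fin n → ℂˣ} (hc : TwistInvariant ψ c) :
    twistHW N ψ hc (HW.vac N ψ) = HW.vac N ψ := by
  have h : twistHW N ψ hc (HW.vac N ψ) =
      (vermaRadical N ψ).mkQ ((vermaIdeal N ψ).mkQ (twistU c 1)) := rfl
  rw [h, map_one]
  rfl

/-- If the weight space of `v` is one-dimensional, then `v` is fixed by the twists. -/
lemma IsHighestWeightVector.twistHW_eq {v : HW N ψ} (hv : IsHighestWeightVector N ψ v)
    {h : cartanLoop H n}
    (hlow : ∀ w : HW N ψ, ∃ c : ℂ, w - c • v ∈ lowerWeights (HW N ψ) (h : loopAlg H n) (ψ h))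
    {c : Fin n → ℂˣ} (hc : TwistInvariant ψ c) : twistHW N ψ hc v = v := by
  obtain ⟨a, ha⟩ := hlow (HW.vac N ψ)
  -- The difference has weight ψ(h), like both of its terms, and lies in the sum of the lower weight
  -- spaces, so it is zero.
  have hvac : HW.vac N ψ = a • v := by
    refine sub_eq_zero.1 (eq_zero_of_mem_lowerWeights ?_ ha)
    rw [lie_sub, lie_smul, HW.lie_vac, hv.cartan, smul_sub, smul_comm]
  have ha0 : a ≠ 0 := by
    rintro rfl
    exact HW.vac_ne_zero hv.ne_zero (by rw [hvac, zero_smul])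
  have := twistHW_vac (N := N) hc
  rw [hvac, map_smul] at this
  exact smul_right_injective _ ha0 this

end HW

/-! ### Triangular decomposition of the loop algebra -/

section LoopTriangular

variable {𝔤 : Type*} [LieRing 𝔤] [LieAlgebra ℂ 𝔤] {H N : Submodule ℂ 𝔤} {n : ℕ}

/-- The decomposition of 𝔤 is tensored with A; bracketing with 1 ⊗ x does not affect the factor in
A. What has to be checked is that for X in 𝔤' the three parts of X again lie in 𝔤', so that their
products with an arbitrary p belong to the loop algebra. -/
lemma mem_span_loop_triangular (hN : N ≤ (derived 𝔤).toSubmodule) {x : 𝔤} {x' : loopAlg H n}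
    (hx' : (x' : Laurent n ⊗[ℂ] 𝔤) = 1 ⊗ₜ x)
    (h𝔤 : ∀ y : 𝔤, y ∈ Submodule.span ℂ {y | ∃ j : ℕ, ⁅x, y⁆ = (-(j + 1) : ℂ) • y} ⊔ H ⊔ N)
    (y : loopAlg H n) :
    y ∈ Submodule.span ℂ {y : loopAlg H n | (∃ j : ℕ, ⁅x', y⁆ = (-(j + 1) : ℂ) • y) ∨
      y ∈ cartanLoop H n ∨ y ∈ posLoop H n N} := by
  set S := {y : loopAlg H n | (∃ j : ℕ, ⁅x', y⁆ = (-(j + 1) : ℂ) • y) ∨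
      y ∈ cartanLoop H n ∨ y ∈ posLoop H n N}
  set T := (Submodule.span ℂ S).map (loopAlg H n).toSubmodule.subtype
  have hST : ∀ y ∈ S, (y : Laurent n ⊗[ℂ] 𝔤) ∈ T :=
    fun y hy => ⟨y, Submodule.subset_span hy, rfl⟩
  have hder : ∀ y, (∃ j : ℕ, ⁅x, y⁆ = (-(j + 1) : ℂ) • y) → y ∈ derived 𝔤 := by
    rintro y ⟨j, hj⟩
    exact mem_derived_of_lie_eq_smul (neg_ne_zero.2 (Nat.cast_add_one_ne_zero j)) hj
  have h1 : loopSub n (derived 𝔤).toSubmodule ≤ T := by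
    refine Submodule.span_le.2 ?_
    rintro _ ⟨p, X, hX, rfl⟩
    obtain ⟨Z, hZ, q, hq, rfl⟩ := Submodule.mem_sup.1 (h𝔤 X)
    obtain ⟨m, hm, h, hh, rfl⟩ := Submodule.mem_sup.1 hZ
    have hm' : m ∈ (derived 𝔤).toSubmodule := Submodule.span_le.2 hder hm
    -- The Cartan part is what remains of X after subtracting two elements of 𝔤'; hence it lies in
    -- 𝔥'.
    have hh' : h ∈ (derived 𝔤).toSubmodule := by
      have := sub_mem (sub_mem hX (hN hq)) hm'
      rwa [add_sub_cancel_right, add_sub_cancel_left] at this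
    rw [TensorProduct.tmul_add, TensorProduct.tmul_add]
    refine add_mem (add_mem ?_ ?_) ?_
    · clear hX hZ hm'
      induction hm using Submodule.span_induction with
      | mem y hy =>
        refine hST ⟨p ⊗ₜ y, Submodule.mem_sup_left (tmul_mem_loopSub p (hder y hy))⟩ (.inl ?_)
        obtain ⟨j, hj⟩ := hy
        refine ⟨j, Subtype.ext ?_⟩
        change ⁅(x' : Laurent n ⊗[ℂ] 𝔤), p ⊗ₜ y⁆ = (-(j + 1) : ℂ) • (p ⊗ₜ y)
        rw [hx', loop_lie_tmul, hj, one_mul, TensorProduct.tmul_smul]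
      | zero => rw [TensorProduct.tmul_zero]; exact zero_mem _
      | add y z _ _ hy hz => rw [TensorProduct.tmul_add]; exact add_mem hy hz
      | smul c y _ hy => rw [TensorProduct.tmul_smul]; exact Submodule.smul_mem _ c hy
    · exact hST ⟨p ⊗ₜ h, Submodule.mem_sup_left (tmul_mem_loopSub p hh')⟩
        (.inr (.inl (Submodule.mem_sup_left (tmul_mem_loopSub p ⟨hh, hh'⟩))))
    · exact hST ⟨p ⊗ₜ q, Submodule.mem_sup_left (tmul_mem_loopSub p (hN hq))⟩
        (.inr (.inr (tmul_mem_loopSub p hq)))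
  have h2 : constSub n H ≤ T := fun z hz =>
    hST ⟨z, Submodule.mem_sup_right hz⟩ (.inr (.inl (Submodule.mem_sup_right hz)))
  obtain ⟨z, hz, hzy⟩ := sup_le h1 h2 y.2
  rwa [← Subtype.ext hzy]

end LoopTriangular

/-! ### Weights of V(ψ) for a Kac-Moody algebra -/

section KacMoody

variable {ι : Type*} [Fintype ι] [DecidableEq ι] {C : Matrix ι ι ℤ}
  {𝔥 : Type*} [AddCommGroup 𝔥] [Module ℂ 𝔥] (ρ : Realization C 𝔥) {n : ℕ}

/-- `V(ψ)` is the sum of the line through a highest weight vector and of the eigenspaces of some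
element `h` of the Cartan subalgebra for eigenvalues `ψ(h) - 1, ψ(h) - 2, …`. -/
lemma IsHighestWeightVector.exists_lowerWeights {ψ : cartanLoop (KM.cartan ρ) n →ₗ[ℂ] ℂ}
    {v : HW (KM.pos ρ) ψ} (hv : IsHighestWeightVector (KM.pos ρ) ψ v) :
    ∃ h : cartanLoop (KM.cartan ρ) n, IsHomog 0 (h : loopAlg (KM.cartan ρ) n) ∧
      ∀ w : HW (KM.pos ρ) ψ, ∃ c : ℂ,
        w - c • v ∈ lowerWeights (HW (KM.pos ρ) ψ) (h : loopAlg (KM.cartan ρ) n) (ψ h) := by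
  obtain ⟨x, hx⟩ := ρ.exists_root_eq_one
  have hmem : (1 : Laurent n) ⊗ₜ[ℂ] KM.h ρ x ∈ constSub n (KM.cartan ρ) :=
    ⟨_, KM.h_mem_cartan ρ x, rfl⟩
  let x' : loopAlg (KM.cartan ρ) n := ⟨1 ⊗ₜ KM.h ρ x, Submodule.mem_sup_right hmem⟩
  refine ⟨⟨x', Submodule.mem_sup_right hmem⟩, ⟨_, rfl⟩, ?_⟩
  refine exists_sub_smul_mem_lowerWeights (hv.cartan _) (fun y => ?_)
    (HW.lieSpan_eq_top hv.ne_zero)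
  have hneg : KM.neg ρ ≤
      Submodule.span ℂ {y | ∃ j : ℕ, ⁅KM.h ρ x, y⁆ = (-(j + 1) : ℂ) • y} :=
    lieSpan_le_span_negative fun i => by rw [KM.h_lie_f, hx]
  refine Submodule.span_mono ?_ (mem_span_loop_triangular (x' := x')
    (KM.pos_le_derived ρ) rfl
    (fun y => sup_le_sup_right (sup_le_sup_right hneg _) _
      (KM.mem_neg_sup_cartan_sup_pos ρ y)) y)
  -- Elements of the Cartan part act on v through ψ, and elements of N⁺ ⊗ A with eigenvalue 0.
  rintro y (hy | hy | hy)
  · exact .inl hy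
  · exact .inr ⟨_, hv.cartan ⟨y, hy⟩⟩
  · exact .inr ⟨0, by rw [hv.pos y hy, zero_smul]⟩

end KacMoody

/-- Subobjects of the members of an independent family whose supremum is everything are equal to
the members of the family. -/
lemma eq_of_le_of_iSupIndep_of_iSup_eq_top {α κ : Type*} [CompleteLattice α] [IsModularLattice α]
    {s t : κ → α} (ht : iSupIndep t) (hst : ∀ k, s k ≤ t k) (hs : ⨆ k, s k = ⊤) (k : κ) :
    s k = t k := by
  have hle : (⊤ : α) ≤ s k ⊔ ⨆ (j) (_ : j ≠ k), t j := by
    rw [← hs]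
    refine iSup_le fun j => ?_
    by_cases h : j = k
    · exact h ▸ le_sup_left
    · exact le_sup_of_le_right ((hst j).trans (le_iSup₂_of_le j h le_rfl))
  -- The other t j meet t k trivially by independence. The modular law then moves s k inside, where
  -- its join with them is everything.
  calc s k = s k ⊔ (⨆ (j) (_ : j ≠ k), t j) ⊓ t k := by
        rw [inf_comm, (ht k).eq_bot, sup_bot_eq]
    _ = t k := by rw [← sup_inf_assoc_of_le _ (hst k), top_le_iff.1 hle, top_inf_eq]

/-! ### Laurent polynomials in the `t_i ^ r_i` -/

/-- The exponents of monomials in the subalgebra form an additive monoid. It contains r_i and -r_i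
times each unit vector, hence all their integer multiples and the sums of these. -/
lemma mono_mem_powSubalgebra {n : ℕ} {r : Fin n → ℕ} {s : Fin n → ℤ}
    (hs : ∀ i, (r i : ℤ) ∣ s i) : mono s ∈ powSubalgebra r := by
  let B : AddSubmonoid (Fin n → ℤ) :=
    { carrier := {s | mono s ∈ powSubalgebra r}
      zero_mem' := one_mem (powSubalgebra r)
      add_mem' := fun {s t} hs ht => by
        change mono (s + t) ∈ powSubalgebra r
        rw [← mono_mul]
        exact mul_mem hs ht }
  have hpos : ∀ i, Pi.single i (r i : ℤ) ∈ B := fun i =>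
    Algebra.subset_adjoin (.inl ⟨i, rfl⟩)
  have hneg : ∀ i, Pi.single i (-(r i : ℤ)) ∈ B := fun i =>
    Algebra.subset_adjoin (.inr ⟨i, rfl⟩)
  have hsingle : ∀ i, Pi.single i (s i) ∈ B := by
    intro i
    obtain ⟨c, hc⟩ := hs i
    rcases Int.eq_nat_or_neg c with ⟨m, rfl | rfl⟩
    · have := B.nsmul_mem (hpos i) m
      rwa [← Pi.single_smul, nsmul_eq_mul, mul_comm, ← hc] at this
    · have := B.nsmul_mem (hneg i) m
      rwa [← Pi.single_smul, nsmul_eq_mul, mul_neg, mul_comm, ← mul_neg, ← hc] at this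
  have := B.sum_mem (t := Finset.univ) fun i _ => hsingle i
  rwa [Finset.univ_sum_single] at this

/-! ### Submodules of `V(ψ) ⊗ A` -/

section Submodules

variable {𝔤 : Type*} [LieRing 𝔤] [LieAlgebra ℂ 𝔤] {H : Submodule ℂ 𝔤} {n : ℕ}
  {N : Submodule ℂ 𝔤} {ψ : cartanLoop H n →ₗ[ℂ] ℂ}
  {S : LieSubmodule ℂ (extLoopAlg H n) (HW N ψ ⊗[ℂ] Laurent n)}

lemma loopAct_mem (x : loopAlg H n) {w : HW N ψ ⊗[ℂ] Laurent n} (hw : w ∈ S) :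
    loopAct x w ∈ S := by
  have h := S.lie_mem (x := (⟨x, 0⟩ : extLoopAlg H n)) hw
  rwa [ext_lie_def, map_zero, LinearMap.zero_apply, add_zero] at h

lemma degAct_mem (d : Deg n) {w : HW N ψ ⊗[ℂ] Laurent n} (hw : w ∈ S) : degAct d w ∈ S := by
  have h := S.lie_mem (x := (⟨0, d⟩ : extLoopAlg H n)) hw
  rwa [ext_lie_def, map_zero, LinearMap.zero_apply, zero_add] at h

lemma IsHomog.lie_tmul_mem {m : Fin n → ℤ} {x : loopAlg H n} (hx : IsHomog m x) {w : HW N ψ}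
    {p : Laurent n} (h : w ⊗ₜ[ℂ] p ∈ S) : ⁅x, w⁆ ⊗ₜ[ℂ] (mono m * p) ∈ S :=
  hx.loopAct_tmul w p ▸ loopAct_mem x h

/-- A submodule containing `v ⊗ A` for some `v ≠ 0` is everything, since `V(ψ)` is irreducible. -/
lemma tmul_mem_of_forall_tmul_mono_mem {v : HW N ψ} (hv : v ≠ 0)
    (h : ∀ m, v ⊗ₜ[ℂ] mono m ∈ S) : S = ⊤ := by
  let p : Submodule ℂ (HW N ψ) :=
    { carrier := {w | ∀ m, w ⊗ₜ[ℂ] mono m ∈ S}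
      add_mem' := fun ha hb m => by rw [TensorProduct.add_tmul]; exact add_mem (ha m) (hb m)
      zero_mem' := fun m => by rw [TensorProduct.zero_tmul]; exact zero_mem _
      smul_mem' := fun c w hw m => by
        rw [← TensorProduct.smul_tmul']; exact S.smul_mem c (hw m) }
  have hp : p = ⊤ := by
    refine HW.eq_top_of_lie_mem (fun x w hw => ?_) (show v ∈ p from h) hv
    induction x using homog_induction with
    | h0 => rw [zero_lie]; exact zero_mem _
    | hadd x y hx hy => rw [add_lie]; exact add_mem hx hy
    | hh k x hx =>
      intro m
      -- Acting by x raises the exponent by k, so t^m is reached from t^(m - k). This is why p asks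
      -- for all exponents at once.
      have := hx.lie_tmul_mem (hw (m - k))
      rwa [mono_mul, add_sub_cancel] at this
  refine eq_top_iff.2 fun z _ => ?_
  induction z using TensorProduct.induction_on with
  | zero => exact zero_mem _
  | add a b ha hb => exact add_mem (ha trivial) (hb trivial)
  | tmul w q =>
    have hw : w ∈ p := hp ▸ Submodule.mem_top
    induction q using mono_induction with
    | h0 => rw [TensorProduct.tmul_zero]; exact zero_mem _
    | hadd q q' hq hq' => rw [TensorProduct.tmul_add]; exact add_mem (hq trivial) (hq' trivial)
    | hmono a m => rw [TensorProduct.tmul_smul]; exact S.smul_mem a (hw m)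

/-- On v ⊗ A, the action of h ⊗ t^m is multiplication by ψ(h ⊗ t^m) t^m, and these elements generate
A_ψ. -/
lemma IsHighestWeightVector.tmul_mul_mem {v : HW N ψ} (hv : IsHighestWeightVector N ψ v)
    {q : Laurent n} (hq : q ∈ weightAlgebra ψ) {p : Laurent n} (hp : v ⊗ₜ[ℂ] p ∈ S) :
    v ⊗ₜ[ℂ] (q * p) ∈ S := by
  induction hq using Algebra.adjoin_induction generalizing p with
  | mem q hq =>
    obtain ⟨h, m, rfl⟩ := hq
    have hx : IsHomog m (cartanMono h m : loopAlg H n) := ⟨_, rfl⟩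
    have := hx.lie_tmul_mem hp
    rwa [hv.cartan, TensorProduct.smul_tmul, ← smul_mul_assoc] at this
  | algebraMap c =>
    rw [← Algebra.smul_def, TensorProduct.tmul_smul]
    exact S.smul_mem c hp
  | add q q' _ _ hq hq' =>
    rw [add_mul, TensorProduct.tmul_add]
    exact add_mem (hq hp) (hq' hp)
  | mul q q' _ _ hq hq' =>
    rw [mul_assoc]
    exact hq (hq' hp)

/-- Congruent exponents differ by a vector with entries divisible by the r_i, so t^(m' - m) lies in
A_ψ. -/
lemma IsHighestWeightVector.tmul_mono_mem {v : HW N ψ} (hv : IsHighestWeightVector N ψ v)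
    {r : Fin n → ℕ} (hψ : weightAlgebra ψ = powSubalgebra r) {m m' : Fin n → ℤ}
    (hm : ∀ i, (m i : ZMod (r i)) = m' i) (h : v ⊗ₜ[ℂ] mono m ∈ S) : v ⊗ₜ[ℂ] mono m' ∈ S := by
  have hmem : mono (m' - m) ∈ weightAlgebra ψ := hψ ▸ mono_mem_powSubalgebra fun i => by
    rw [← ZMod.intCast_zmod_eq_zero_iff_dvd, Pi.sub_apply, Int.cast_sub, hm, sub_self]
  have := hv.tmul_mul_mem hmem h
  rwa [mono_mul, sub_add_cancel] at this

/-- A nonzero submodule contains a nonzero homogeneous vector. -/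
lemma exists_tmul_mono_mem (hS : S ≠ ⊥) : ∃ (w : HW N ψ) (m : Fin n → ℤ),
    w ≠ 0 ∧ w ⊗ₜ[ℂ] mono m ∈ S := by
  obtain ⟨z, hz, hz0⟩ : ∃ z ∈ S, z ≠ 0 := by
    by_contra! h
    exact hS ((LieSubmodule.eq_bot_iff S).2 h)
  obtain ⟨b, rfl⟩ := TensorProduct.eq_repr_basis_right (monoBasis n) z
  -- The component of exponent m has eigenvalue m_i under d_i, so the d_i separate the exponents.
  have hmem := mem_of_sum_jointEigenvectors_mem
    (f := fun i : Fin n => degAct (N := N) (ψ := ψ) (Deg.coord.symm (Pi.single i 1)))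
    (p := S.toSubmodule) (fun i x hx => degAct_mem _ hx)
    (χ := fun (m : Fin n → ℤ) i => (m i : ℂ))
    (fun m m' h => funext fun i => Int.cast_injective (congrFun h i)) b.support
    (fun m => b m ⊗ₜ[ℂ] monoBasis n m)
    (fun m _ i => by
      rw [degAct_tmul, LinearEquiv.apply_symm_apply, monoBasis_apply, degDer_mono,
        TensorProduct.tmul_smul]
      congr 1
      simp [Pi.single_apply])
    hz
  obtain ⟨m, hm, hne⟩ := Finset.exists_ne_zero_of_sum_ne_zero hz0
  exact ⟨b m, m, fun h => hne (by beta_reduce; rw [h, TensorProduct.zero_tmul]), hmem m hm⟩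

/-- A nonzero submodule contains some `v ⊗ t^m`. -/
lemma IsHighestWeightVector.exists_tmul_mono_mem {v : HW N ψ} (hv : IsHighestWeightVector N ψ v)
    {h : cartanLoop H n} (hh : IsHomog 0 (h : loopAlg H n))
    (hlow : ∀ w : HW N ψ, ∃ c : ℂ, w - c • v ∈ lowerWeights (HW N ψ) (h : loopAlg H n) (ψ h))
    (hS : S ≠ ⊥) : ∃ m : Fin n → ℤ, v ⊗ₜ[ℂ] mono m ∈ S := by
  obtain ⟨w, m, hw0, hw⟩ := LoopKM.exists_tmul_mono_mem hS
  -- Different w may come with different exponents, hence the span. It is stable under the loop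
  -- algebra because a homogeneous element only shifts the exponent.
  have htop : Submodule.span ℂ {w : HW N ψ | ∃ m, w ⊗ₜ[ℂ] mono m ∈ S} = ⊤ := by
    refine HW.eq_top_of_lie_mem (fun x z hz => ?_) (Submodule.subset_span ⟨m, hw⟩) hw0
    induction x using homog_induction with
    | h0 => rw [zero_lie]; exact zero_mem _
    | hadd x y hx hy => rw [add_lie]; exact add_mem hx hy
    | hh k x hx =>
      induction hz using Submodule.span_induction with
      | mem z hz =>
        obtain ⟨l, hl⟩ := hz
        exact Submodule.subset_span ⟨k + l, mono_mul k l ▸ hx.lie_tmul_mem hl⟩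
      | zero => rw [lie_zero]; exact zero_mem _
      | add y z _ _ hy hz => rw [lie_add]; exact add_mem hy hz
      | smul c y _ hy => rw [lie_smul]; exact Submodule.smul_mem _ c hy
  -- Otherwise the lower weight spaces would contain all of V(ψ), in particular v, which has weight
  -- ψ(h) and is nonzero.
  obtain ⟨w, ⟨m, hw⟩, hlw⟩ : ∃ w : HW N ψ, (∃ m, w ⊗ₜ[ℂ] mono m ∈ S) ∧
      w ∉ lowerWeights (HW N ψ) (h : loopAlg H n) (ψ h) := by
    by_contra! hcon
    have hle : Submodule.span ℂ {w : HW N ψ | ∃ m, w ⊗ₜ[ℂ] mono m ∈ S} ≤ _ :=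
      Submodule.span_le.2 fun w hw => hcon w hw
    exact hv.ne_zero (eq_zero_of_mem_lowerWeights (hv.cartan h)
      (hle (htop ▸ Submodule.mem_top)))
  obtain ⟨c, hc⟩ := hlow w
  have hc0 : c ≠ 0 := by
    rintro rfl
    rw [zero_smul, sub_zero] at hc
    exact hlw hc
  let p : Submodule ℂ (HW N ψ) :=
    S.toSubmodule.comap ((TensorProduct.mk ℂ (HW N ψ) (Laurent n)).flip (mono m))
  -- Since h has loop degree 0, it preserves the slice of S at t^m, so c • v can be split off within
  -- that slice.
  have hp : ∀ z ∈ p, ⁅(h : loopAlg H n), z⁆ ∈ p := fun z hz => by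
    have h := hh.lie_tmul_mem (S := S) (w := z) (p := mono m) hz
    rw [mono_zero, one_mul] at h
    exact h
  have hcv : c • v ∈ p := mem_of_add_lowerWeights_mem hp
    (by rw [lie_smul, hv.cartan, smul_comm]) hc (by rw [add_sub_cancel]; exact hw)
  exact ⟨m, show v ∈ p from (p.smul_mem_iff hc0).1 hcv⟩

end Submodules

/-! ### The joint eigenspaces -/

section JointEigenspace

variable {𝔤 : Type*} [LieRing 𝔤] [LieAlgebra ℂ 𝔤] {H : Submodule ℂ 𝔤} {n : ℕ}
  {N : Submodule ℂ 𝔤} {ψ : cartanLoop H n →ₗ[ℂ] ℂ} {r : Fin n → ℕ}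
  (hψ : weightAlgebra ψ = powSubalgebra r) {ξ : Fin n → ℂˣ}
  (hξ : ∀ i, IsPrimitiveRoot (ξ i) (r i))

lemma jointEigenspace_toSubmodule (k : (i : Fin n) → ZMod (r i)) :
    (jointEigenspace N hψ hξ k).toSubmodule = ⨅ i, (etaTildeAt N hψ hξ i).eigenspace
      ((ξ i ^ (-((k i).val : ℤ)) : ℂˣ) : ℂ) := rfl

/-- Powers of a primitive r_i-th root of unity with exponents in [0, r_i) are distinct, so different
k give different systems of eigenvalues. -/
lemma iSupIndep_jointEigenspace (hr : ∀ i, 0 < r i) :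
    iSupIndep fun k => (jointEigenspace N hψ hξ k).toSubmodule := by
  rw [funext (jointEigenspace_toSubmodule hψ hξ)]
  refine iSupIndep_iInf_eigenspace (etaTildeAt N hψ hξ)
    (χ := fun (k : (i : Fin n) → ZMod (r i)) i => ((ξ i ^ (-((k i).val : ℤ)) : ℂˣ) : ℂ))
    fun k l hkl => funext fun i => ?_
  have : NeZero (r i) := ⟨(hr i).ne'⟩
  have h := Units.ext (congrFun hkl i)
  rw [zpow_neg, zpow_neg, inv_inj, zpow_natCast, zpow_natCast] at h
  exact ZMod.val_injective _ ((hξ i).pow_inj (ZMod.val_lt _) (ZMod.val_lt _) h)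

/-- As σ_i fixes v, only the substitution in the second factor counts. It multiplies t^m by
ξ_i^(-m_i), which depends on m_i modulo r_i. -/
lemma tmul_mono_mem_jointEigenspace (hr : ∀ i, 0 < r i) {v : HW N ψ}
    (hv : ∀ (c : Fin n → ℂˣ) (hc : TwistInvariant ψ c), twistHW N ψ hc v = v)
    {k : (i : Fin n) → ZMod (r i)} {m : Fin n → ℤ} (hm : ∀ i, (m i : ZMod (r i)) = k i) :
    v ⊗ₜ[ℂ] mono m ∈ jointEigenspace N hψ hξ k := by
  rw [← LieSubmodule.mem_toSubmodule, jointEigenspace_toSubmodule, Submodule.mem_iInf]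
  intro i
  have : NeZero (r i) := ⟨(hr i).ne'⟩
  rw [Module.End.mem_eigenspace_iff, etaTildeAt, etaTilde_tmul, hv, rescale_mono,
    TensorProduct.tmul_smul]
  congr 1
  rw [charPow, Finset.prod_eq_single i]
  · congr 1
    rw [Pi.inv_apply, Pi.mulSingle_eq_same, inv_zpow', eq_comm, ← div_eq_one, div_eq_mul_inv, ← zpow_sub,
      (hξ i).zpow_eq_one_iff_dvd, ← ZMod.intCast_zmod_eq_zero_iff_dvd]
    simp [hm]
  · intro j _ hj
    rw [Pi.inv_apply, Pi.mulSingle_eq_of_ne hj, inv_one, one_zpow]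
  · exact fun h => absurd (Finset.mem_univ i) h

end JointEigenspace

/-! ### The irreducible components of V(ψ) ⊗ A -/

section Components

variable {𝔤 : Type*} [LieRing 𝔤] [LieAlgebra ℂ 𝔤] {H : Submodule ℂ 𝔤} {n : ℕ}
  {N : Submodule ℂ 𝔤} {ψ : cartanLoop H n →ₗ[ℂ] ℂ} {r : Fin n → ℕ}

/-- Every v ⊗ t^m lies in the submodule generated at the standard representative of the class of m,
so the sum contains v ⊗ A. -/
lemma IsHighestWeightVector.iSup_lieSpan_eq_top
    (hψ : weightAlgebra ψ = powSubalgebra r) (hr : ∀ i, 0 < r i) {v : HW N ψ}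
    (hv : IsHighestWeightVector N ψ v) :
    ⨆ k : (i : Fin n) → ZMod (r i), LieSubmodule.lieSpan ℂ (extLoopAlg H n)
      {v ⊗ₜ[ℂ] mono fun i => ((k i).val : ℤ)} = ⊤ := by
  refine tmul_mem_of_forall_tmul_mono_mem hv.ne_zero fun m => ?_
  refine (le_iSup (fun k : (i : Fin n) → ZMod (r i) => LieSubmodule.lieSpan ℂ (extLoopAlg H n)
    {v ⊗ₜ[ℂ] mono fun i => ((k i).val : ℤ)}) fun i => (m i : ZMod (r i))) ?_
  refine hv.tmul_mono_mem hψ (fun i => ?_) (LieSubmodule.subset_lieSpan rfl)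
  have : NeZero (r i) := ⟨(hr i).ne'⟩
  simp

variable (hψ : weightAlgebra ψ = powSubalgebra r) {ξ : Fin n → ℂˣ}
  (hξ : ∀ i, IsPrimitiveRoot (ξ i) (r i))

/-- The generated submodules lie in independent eigenspaces and add up to the whole module; this
forces equality without any description of the vectors of an eigenspace. -/
lemma IsHighestWeightVector.lieSpan_val_eq_jointEigenspace (hr : ∀ i, 0 < r i) {v : HW N ψ}
    (hv : IsHighestWeightVector N ψ v)
    (htw : ∀ (c : Fin n → ℂˣ) (hc : TwistInvariant ψ c), twistHW N ψ hc v = v)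
    (k : (i : Fin n) → ZMod (r i)) :
    LieSubmodule.lieSpan ℂ (extLoopAlg H n) {v ⊗ₜ[ℂ] mono fun i => ((k i).val : ℤ)} =
      jointEigenspace N hψ hξ k := by
  rw [← LieSubmodule.toSubmodule_inj]
  refine eq_of_le_of_iSupIndep_of_iSup_eq_top
    (s := fun k : (i : Fin n) → ZMod (r i) => (LieSubmodule.lieSpan ℂ (extLoopAlg H n)
      {v ⊗ₜ[ℂ] mono fun i => ((k i).val : ℤ)}).toSubmodule)
    (t := fun k => (jointEigenspace N hψ hξ k).toSubmodule)
    (iSupIndep_jointEigenspace hψ hξ hr) (fun k => ?_) ?_ k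
  · refine LieSubmodule.toSubmodule_le_toSubmodule _ _ |>.2 (LieSubmodule.lieSpan_le.2 ?_)
    rintro _ rfl
    refine tmul_mono_mem_jointEigenspace hψ hξ hr htw fun i => ?_
    have : NeZero (r i) := ⟨(hr i).ne'⟩
    simp
  · rw [LieSubmodule.iSup_toSubmodule_eq_top]
    exact hv.iSup_lieSpan_eq_top hψ hr

lemma IsHighestWeightVector.lieSpan_eq_jointEigenspace (hr : ∀ i, 0 < r i) {v : HW N ψ}
    (hv : IsHighestWeightVector N ψ v)
    (htw : ∀ (c : Fin n → ℂˣ) (hc : TwistInvariant ψ c), twistHW N ψ hc v = v)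
    {k : (i : Fin n) → ZMod (r i)} {m : Fin n → ℤ} (hm : ∀ i, (m i : ZMod (r i)) = k i) :
    LieSubmodule.lieSpan ℂ (extLoopAlg H n) {v ⊗ₜ[ℂ] mono m} = jointEigenspace N hψ hξ k := by
  refine le_antisymm (LieSubmodule.lieSpan_le.2 ?_) ?_
  · rintro _ rfl
    exact tmul_mono_mem_jointEigenspace hψ hξ hr htw hm
  · rw [← hv.lieSpan_val_eq_jointEigenspace hψ hξ hr htw, LieSubmodule.lieSpan_le]
    rintro _ rfl
    refine hv.tmul_mono_mem hψ (fun i => ?_) (LieSubmodule.subset_lieSpan rfl)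
    have : NeZero (r i) := ⟨(hr i).ne'⟩
    simp [hm]

lemma tmul_mono_ne_zero {v : HW N ψ} (hv : v ≠ 0) (m : Fin n → ℤ) : v ⊗ₜ[ℂ] mono m ≠ 0 := by
  intro h
  have h' := congrArg (TensorProduct.equivFinsuppOfBasisRight (M := HW N ψ) (monoBasis n)) h
  rw [map_zero] at h'
  have h'' := DFunLike.congr_fun h' m
  rw [TensorProduct.equivFinsuppOfBasisRight_apply_tmul_apply, ← monoBasis_apply,
    Module.Basis.repr_self, Finsupp.single_eq_same, one_smul] at h''
  exact hv h''

lemma IsHighestWeightVector.eq_jointEigenspace (hr : ∀ i, 0 < r i) {v : HW N ψ}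
    (hv : IsHighestWeightVector N ψ v)
    (htw : ∀ (c : Fin n → ℂˣ) (hc : TwistInvariant ψ c), twistHW N ψ hc v = v)
    {k : (i : Fin n) → ZMod (r i)}
    {S : LieSubmodule ℂ (extLoopAlg H n) (HW N ψ ⊗[ℂ] Laurent n)}
    (hS : S ≤ jointEigenspace N hψ hξ k) {m : Fin n → ℤ} (hm : v ⊗ₜ[ℂ] mono m ∈ S) :
    S = jointEigenspace N hψ hξ k := by
  -- Otherwise the nonzero vector v ⊗ t^m would belong to two different joint eigenspaces.
  have hmk : (fun i => (m i : ZMod (r i))) = k := by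
    by_contra hne
    refine tmul_mono_ne_zero hv.ne_zero m (Submodule.disjoint_def.1
      ((iSupIndep_jointEigenspace hψ hξ hr).pairwiseDisjoint hne) _ ?_ (hS hm))
    exact tmul_mono_mem_jointEigenspace hψ hξ hr htw fun _ => rfl
  refine le_antisymm hS ?_
  rw [← hv.lieSpan_eq_jointEigenspace hψ hξ hr htw (congrFun hmk), LieSubmodule.lieSpan_le]
  rintro _ rfl
  exact hm

lemma IsHighestWeightVector.isIrreducible_jointEigenspace (hr : ∀ i, 0 < r i) {v : HW N ψ}
    (hv : IsHighestWeightVector N ψ v) {h : cartanLoop H n}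
    (hh : IsHomog 0 (h : loopAlg H n))
    (hlow : ∀ w : HW N ψ, ∃ c : ℂ, w - c • v ∈ lowerWeights (HW N ψ) (h : loopAlg H n) (ψ h))
    (k : (i : Fin n) → ZMod (r i)) :
    LieModule.IsIrreducible ℂ (extLoopAlg H n) (jointEigenspace N hψ hξ k) := by
  have htw := fun c (hc : TwistInvariant ψ c) => hv.twistHW_eq hlow hc
  have hmem : v ⊗ₜ[ℂ] mono (fun i => ((k i).val : ℤ)) ∈ jointEigenspace N hψ hξ k := by
    rw [← hv.lieSpan_val_eq_jointEigenspace hψ hξ hr htw]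
    exact LieSubmodule.subset_lieSpan rfl
  have : Nontrivial (jointEigenspace N hψ hξ k) :=
    ⟨⟨_, hmem⟩, 0, fun h0 => tmul_mono_ne_zero hv.ne_zero _ (congrArg Subtype.val h0)⟩
  refine LieModule.IsIrreducible.mk fun T hT => ?_
  have hinj : Function.Injective (jointEigenspace N hψ hξ k).incl := Subtype.val_injective
  -- T is viewed inside V(ψ) ⊗ A, where a nonzero submodule contains some v ⊗ t^m.
  have hT' : T.map (jointEigenspace N hψ hξ k).incl ≠ ⊥ := fun h0 =>
    hT ((LieSubmodule.eq_bot_iff T).2 fun z hz => hinj (by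
      rw [map_zero]
      exact (LieSubmodule.eq_bot_iff _).1 h0 _ (LieSubmodule.mem_map_of_mem hz)))
  obtain ⟨m, hm⟩ := hv.exists_tmul_mono_mem hh hlow hT'
  have hE := hv.eq_jointEigenspace hψ hξ hr htw (k := k)
    (S := T.map (jointEigenspace N hψ hξ k).incl)
    (by rintro _ ⟨z, -, rfl⟩; exact z.2) hm
  refine eq_top_iff.2 fun z _ => ?_
  obtain ⟨y, hy, hyz⟩ := (LieSubmodule.mem_map _).1 (hE.ge z.2)
  exact hinj hyz ▸ hy

lemma IsHighestWeightVector.isInternal_jointEigenspace (hr : ∀ i, 0 < r i) {v : HW N ψ}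
    (hv : IsHighestWeightVector N ψ v)
    (htw : ∀ (c : Fin n → ℂˣ) (hc : TwistInvariant ψ c), twistHW N ψ hc v = v) :
    DirectSum.IsInternal fun k => (jointEigenspace N hψ hξ k).toSubmodule := by
  rw [DirectSum.isInternal_submodule_iff_iSupIndep_and_iSup_eq_top]
  refine ⟨iSupIndep_jointEigenspace hψ hξ hr, ?_⟩
  rw [LieSubmodule.iSup_toSubmodule_eq_top, ← hv.iSup_lieSpan_eq_top hψ hr]
  exact iSup_congr fun k => (hv.lieSpan_val_eq_jointEigenspace hψ hξ hr htw k).symm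

end Components

end LoopKM

end

theorem theorem4p2 {ι : Type*} [Fintype ι] [DecidableEq ι] (C : Matrix ι ι ℤ)
    (hC : LoopKM.IsGCM C) {𝔥 : Type*} [AddCommGroup 𝔥] [Module ℂ 𝔥]
    (ρ : LoopKM.Realization C 𝔥) (n : ℕ)
    (ψ : LoopKM.cartanLoop (LoopKM.KM.cartan ρ) n →ₗ[ℂ] ℂ)
    (r : Fin n → ℕ) (hr : ∀ i, 0 < r i)
    (hψ : LoopKM.weightAlgebra ψ = LoopKM.powSubalgebra r)
    (ξ : Fin n → ℂˣ) (hξ : ∀ i, IsPrimitiveRoot (ξ i) (r i))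
    (v : LoopKM.HW (LoopKM.KM.pos ρ) ψ)
    (hv : LoopKM.IsHighestWeightVector (LoopKM.KM.pos ρ) ψ v) :
    (∀ (k : (i : Fin n) → ZMod (r i)) (m : Fin n → ℤ), (∀ i, (m i : ZMod (r i)) = k i) →
      LieSubmodule.lieSpan ℂ (LoopKM.extLoopAlg (LoopKM.KM.cartan ρ) n)
          {v ⊗ₜ[ℂ] LoopKM.mono m} =
        LoopKM.jointEigenspace (LoopKM.KM.pos ρ) hψ hξ k) ∧
    (∀ k, LieModule.IsIrreducible ℂ (LoopKM.extLoopAlg (LoopKM.KM.cartan ρ) n)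
      (LoopKM.jointEigenspace (LoopKM.KM.pos ρ) hψ hξ k)) ∧
    DirectSum.IsInternal
      (fun k => (LoopKM.jointEigenspace (LoopKM.KM.pos ρ) hψ hξ k).toSubmodule) := by
  -- The Kac-Moody structure enters only here, through the height grading; the remaining arguments
  -- work for any 𝔤, H and N with such an element h.
  obtain ⟨h, hh, hlow⟩ := hv.exists_lowerWeights
  have htw := fun c (hc : LoopKM.TwistInvariant ψ c) => hv.twistHW_eq hlow hc
  exact ⟨fun k m hm => hv.lieSpan_eq_jointEigenspace hψ hξ hr htw hm,
    fun k => hv.isIrreducible_jointEigenspace hψ hξ hr hh hlow k,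
    hv.isInternal_jointEigenspace hψ hξ hr htw⟩
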